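/- Conventions. Hilbert spaces are complex and finite-dimensional. An \emph{H*-category} is a category whose hom-sets are Hilbert spaces with bilinear composition, equipped with antilinear maps $*\colon \hom(x,y)\to\hom(y,x)$ such that, writing $fg$ for "$f$, then $g$", $f^{**}=f$, $(fg)^*=g^*f^*$, $\langle fg,h\rangle=\langle g,f^*h\rangle$ and $\langle fg,h\rangle=\langle f,hg^*\rangle$. A \emph{2-Hilbert space} is an abelian H*-category; a \emph{morphism} of 2-Hilbert spaces is an exact functor that is linear on hom-spaces and satisfies $F(f^*)=F(f)^*$. A morphism $u$ is \emph{unitary} if $uu^*=1$ and $u^*u=1$. A \emph{symmetric 2-H*-algebra} is a 2-Hilbert space with a symmetric monoidal structure whose product is a morphism of 2-Hilbert spaces in each variable, whose associator, unit laws and symmetry are unitary, and in which every object has a left dual. A \emph{homomorphism} of symmetric 2-H*-algebras is a symmetric monoidal functor (with invertible structure maps) that is a morphism of 2-Hilbert spaces; it is an \emph{equivalence} if there is a homomorphism in the other direction that is inverse to it up to invertible monoidal natural transformations. Let $T$ be a compact abelian group. Let $\mathrm{Rep}(T)$ be the category of finite-dimensional continuous unitary representations of $T$ and intertwiners, with the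 usual tensor product and symmetry, the inner product $\langle f,g\rangle=\mathrm{tr}(f^*g)$ on hom-spaces, and $f^*$ the Hilbert space adjoint. Let $\hat T$ be the discrete abelian group of isomorphism classes of irreducible representations of $T$, with $[\rho][\rho']=[\rho\otimes\rho']$ and $[\rho]^{-1}=[\rho^*]$. For a discrete abelian group $G$, let $\mathrm{Hilb}[G]$ be the category of $G$-graded Hilbert spaces $x=\bigoplus_{g\in G}x(g)$ (orthogonal direct sum) of finite total dimension and grading-preserving linear maps, again with $\langle f,g\rangle=\mathrm{tr}(f^*g)$ and $f^*$ the adjoint, with the convolution tensor product $$(x\otimes y)(g)=\bigoplus_{g'g''=g}x(g')\otimes y(g''),$$ with unit $\mathbb C$ in degree $1$, and with symmetry $v\otimes w\mapsto w\otimes v$. The \emph{categorified Fourier transform} $F\colon\mathrm{Rep}(T)\to\mathrm{Hilb}[\hat T]$ sends a representation $x$ to the family $\{x(g)\}_{g\in\hat T}$ of its isotypic components ($x(g)$ is the sum of the images of all intertwiners into $x$ from irreducible representations in the class $g$), and sends an intertwiner to the same linear map. Theorem. For every compact abelian group $T$, $\mathrm{Rep}(T)$ and $\mathrm{Hilb}[\hat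 T]$ are symmetric 2-H*-algebras, and $F$, with the structure maps $F(x)\otimes F(y)\to F(x\otimes y)$ and $\mathbb C\to F(1)$ that are the identity on the underlying Hilbert spaces, is an equivalence of symmetric 2-H*-algebras. -/

import Mathlib

open CategoryTheory CategoryTheory.Limits MonoidalCategory
open scoped TensorProduct

universe v u

/-! ## 2-Hilbert spaces and symmetric 2-H*-algebras -/

/-- An H*-category.  The instances `Preadditive` and `Linear ℂ` make the hom-sets complex vector
spaces with bilinear composition; `homInner` and `finite` make them (finite-dimensional) Hilbert
spaces; `dagger` is the `*`-structure.  As everywhere in Mathlib, inner products are conjugate-linear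
in the first variable. -/
class HStarCategory (C : Type u) [Category.{v} C] [Preadditive C] [Linear ℂ C] where
  homInner : ∀ X Y : C, InnerProductSpace.Core ℂ (X ⟶ Y)
  finite : ∀ X Y : C, Module.Finite ℂ (X ⟶ Y)
  dagger : ∀ {X Y : C}, (X ⟶ Y) → (Y ⟶ X)
  dagger_add : ∀ {X Y : C} (f g : X ⟶ Y), dagger (f + g) = dagger f + dagger g
  dagger_smul : ∀ {X Y : C} (c : ℂ) (f : X ⟶ Y),
    dagger (c • f) = (starRingEnd ℂ) c • dagger f
  dagger_dagger : ∀ {X Y : C} (f : X ⟶ Y), dagger (dagger f) = f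
  dagger_comp : ∀ {X Y Z : C} (f : X ⟶ Y) (g : Y ⟶ Z), dagger (f ≫ g) = dagger g ≫ dagger f
  inner_comp_left : ∀ {X Y Z : C} (f : X ⟶ Y) (g : Y ⟶ Z) (h : X ⟶ Z),
    (homInner X Z).inner (f ≫ g) h = (homInner Y Z).inner g (dagger f ≫ h)
  inner_comp_right : ∀ {X Y Z : C} (f : X ⟶ Y) (g : Y ⟶ Z) (h : X ⟶ Z),
    (homInner X Z).inner (f ≫ g) h = (homInner X Y).inner f (h ≫ dagger g)

namespace HStarCategory

/-- A morphism `f` with `f f* = 1` and `f* f = 1`. -/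
def IsUnitary {C : Type u} [Category.{v} C] [Preadditive C] [Linear ℂ C] [HStarCategory C]
    {X Y : C} (f : X ⟶ Y) : Prop :=
  f ≫ dagger f = 𝟙 X ∧ dagger f ≫ f = 𝟙 Y

end HStarCategory

/-- A 2-Hilbert space is an H*-category which is abelian: it has a zero object, binary direct sums,
kernels and cokernels, and every mono is a kernel and every epi is a cokernel. -/
structure IsTwoHilbertSpace (C : Type u) [Category.{v} C] [Preadditive C] [Linear ℂ C]
    [HStarCategory C] : Prop where
  hasZeroObject : HasZeroObject C
  hasBinaryBiproducts : HasBinaryBiproducts C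
  hasKernels : HasKernels C
  hasCokernels : HasCokernels C
  normalMono : IsNormalMonoCategory C
  normalEpi : IsNormalEpiCategory C

/-- A morphism of 2-Hilbert spaces is an exact functor that is linear on hom-spaces and preserves
the `*`-structure. -/
structure IsTwoHilbertMorphism {C : Type*} [Category* C] [Preadditive C] [Linear ℂ C]
    [HStarCategory C] {D : Type*} [Category* D] [Preadditive D] [Linear ℂ D] [HStarCategory D]
    (F : C ⥤ D) : Prop where
  additive : F.Additive
  linear : F.Linear ℂ
  map_dagger : ∀ {X Y : C} (f : X ⟶ Y),
    F.map (HStarCategory.dagger f) = HStarCategory.dagger (F.map f)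
  exact : ∀ S : ShortComplex C, S.ShortExact → (S.map F).ShortExact

/-- A 2-H*-algebra is a 2-Hilbert space with a monoidal structure whose product is a bimorphism, whose
associator and unit laws are unitary, and in which every object `X` has a left dual, that is, an
object `Y` with morphisms `𝟙 ⟶ X ⊗ Y` and `Y ⊗ X ⟶ 𝟙` satisfying the triangle identities. -/
structure IsTwoHStarAlgebra (C : Type u) [Category.{v} C] [Preadditive C] [Linear ℂ C]
    [HStarCategory C] [MonoidalCategory C] : Prop extends IsTwoHilbertSpace C where
  tensorLeft_morphism : ∀ X : C, IsTwoHilbertMorphism (tensorLeft X)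
  tensorRight_morphism : ∀ X : C, IsTwoHilbertMorphism (tensorRight X)
  unitary_associator : ∀ X Y Z : C, HStarCategory.IsUnitary (α_ X Y Z).hom
  unitary_leftUnitor : ∀ X : C, HStarCategory.IsUnitary (λ_ X).hom
  unitary_rightUnitor : ∀ X : C, HStarCategory.IsUnitary (ρ_ X).hom
  exists_dual : ∀ X : C, ∃ Y : C, Nonempty (ExactPairing X Y)

/-- A symmetric 2-H*-algebra is a 2-H*-algebra with a unitary braiding that is a symmetry. -/
structure IsSymmetricTwoHStarAlgebra (C : Type u) [Category.{v} C] [Preadditive C] [Linear ℂ C]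
    [HStarCategory C] [MonoidalCategory C] [SymmetricCategory C] : Prop
    extends IsTwoHStarAlgebra C where
  unitary_braiding : ∀ X Y : C, HStarCategory.IsUnitary (β_ X Y).hom

/-- A symmetric monoidal functor `F` is an equivalence of symmetric 2-H*-algebras if it is a
homomorphism (a morphism of 2-Hilbert spaces) and there is a homomorphism `G` in the other direction
such that `F` and `G` are inverse to each other up to invertible monoidal natural transformations. -/
structure IsSymmetricTwoHStarEquivalence {C : Type*} [Category* C] [Preadditive C] [Linear ℂ C]
    [HStarCategory C] [MonoidalCategory C] [SymmetricCategory C] {D : Type*} [Category* D]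
    [Preadditive D] [Linear ℂ D] [HStarCategory D] [MonoidalCategory D] [SymmetricCategory D]
    (F : C ⥤ D) [F.Braided] : Prop where
  isTwoHilbertMorphism : IsTwoHilbertMorphism F
  exists_inverse : ∃ (G : D ⥤ C) (_ : G.Braided), IsTwoHilbertMorphism G ∧
    ∃ (η : 𝟭 C ≅ F ⋙ G) (ε : G ⋙ F ≅ 𝟭 D),
      NatTrans.IsMonoidal η.hom ∧ NatTrans.IsMonoidal ε.hom

/-! ## Hilbert spaces -/

section Hilb

variable {V W U : Type} [NormedAddCommGroup V] [InnerProductSpace ℂ V] [FiniteDimensional ℂ V]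
  [NormedAddCommGroup W] [InnerProductSpace ℂ W] [FiniteDimensional ℂ W]
  [NormedAddCommGroup U] [InnerProductSpace ℂ U] [FiniteDimensional ℂ U]

theorem hilbSchmidt_conj (f g : V →ₗ[ℂ] W) :
    (starRingEnd ℂ) (LinearMap.trace ℂ V (LinearMap.adjoint g ∘ₗ f)) =
      LinearMap.trace ℂ V (LinearMap.adjoint f ∘ₗ g) := by
  rw [LinearMap.trace_eq_sum_inner _ (stdOrthonormalBasis ℂ V),
    LinearMap.trace_eq_sum_inner _ (stdOrthonormalBasis ℂ V), map_sum]
  refine Finset.sum_congr rfl fun i _ => ?_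
  simp only [LinearMap.comp_apply, LinearMap.adjoint_inner_right, inner_conj_symm]

theorem hilbSchmidt_self (f : V →ₗ[ℂ] W) :
    LinearMap.trace ℂ V (LinearMap.adjoint f ∘ₗ f) =
      ((∑ i, ‖f (stdOrthonormalBasis ℂ V i)‖ ^ 2 : ℝ) : ℂ) := by
  rw [LinearMap.trace_eq_sum_inner _ (stdOrthonormalBasis ℂ V)]
  push_cast
  refine Finset.sum_congr rfl fun i _ => ?_
  change inner ℂ _ (LinearMap.adjoint f (f _)) = _
  rw [LinearMap.adjoint_inner_right, inner_self_eq_norm_sq_to_K]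
  rfl

/-- The inner product `⟪f, g⟫ = tr (f* g)` on a space of linear maps between Hilbert spaces. -/
@[reducible]
noncomputable def hilbSchmidtCore (S : Submodule ℂ (V →ₗ[ℂ] W)) : InnerProductSpace.Core ℂ S where
  inner f g := LinearMap.trace ℂ V (LinearMap.adjoint f.1 ∘ₗ g.1)
  conj_inner_symm f g := hilbSchmidt_conj f.1 g.1
  re_inner_nonneg f := by
    rw [hilbSchmidt_self, RCLike.re_eq_complex_re, Complex.ofReal_re]
    exact Finset.sum_nonneg fun i _ => sq_nonneg ‖f.1 (stdOrthonormalBasis ℂ V i)‖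
  add_left f g h := by
    simp [LinearMap.add_comp]
  smul_left f g c := by
    simp [map_smulₛₗ, LinearMap.smul_comp]
  definite f hf := by
    rw [hilbSchmidt_self] at hf
    have h0 := Complex.ofReal_eq_zero.1 hf
    rw [Finset.sum_eq_zero_iff_of_nonneg (fun i _ => by positivity)] at h0
    refine Subtype.ext ((stdOrthonormalBasis ℂ V).toBasis.ext fun i => ?_)
    simpa using h0 i (Finset.mem_univ i)

theorem adjoint_smul_complex (c : ℂ) (f : V →ₗ[ℂ] W) :
    LinearMap.adjoint (c • f) = (starRingEnd ℂ) c • LinearMap.adjoint f :=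
  map_smulₛₗ _ c f

theorem adjoint_comp_complex (f : V →ₗ[ℂ] W) (g : W →ₗ[ℂ] U) :
    LinearMap.adjoint (g ∘ₗ f) = LinearMap.adjoint f ∘ₗ LinearMap.adjoint g :=
  LinearMap.adjoint_comp g f

theorem hilbSchmidt_comp_left (f : V →ₗ[ℂ] W) (g : W →ₗ[ℂ] U) (h : V →ₗ[ℂ] U) :
    LinearMap.trace ℂ V (LinearMap.adjoint (g ∘ₗ f) ∘ₗ h) =
      LinearMap.trace ℂ W (LinearMap.adjoint g ∘ₗ (h ∘ₗ LinearMap.adjoint f)) := by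
  rw [LinearMap.adjoint_comp, LinearMap.comp_assoc, LinearMap.trace_comp_comm', 
    LinearMap.comp_assoc]

theorem hilbSchmidt_comp_right (f : V →ₗ[ℂ] W) (g : W →ₗ[ℂ] U) (h : V →ₗ[ℂ] U) :
    LinearMap.trace ℂ V (LinearMap.adjoint (g ∘ₗ f) ∘ₗ h) =
      LinearMap.trace ℂ V (LinearMap.adjoint f ∘ₗ (LinearMap.adjoint g ∘ₗ h)) := by
  rw [LinearMap.adjoint_comp, LinearMap.comp_assoc]

end Hilb

/-! ## The category `Rep(T)` -/

/-- A finite-dimensional continuous unitary representation of a topological group. -/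
structure UnitaryRep (T : Type u) [Group T] [TopologicalSpace T] where
  V : Type
  [normed : NormedAddCommGroup V]
  [innerProduct : InnerProductSpace ℂ V]
  [finiteDimensional : FiniteDimensional ℂ V]
  ρ : Representation ℂ T V
  inner_map : ∀ (t : T) (v w : V), inner ℂ (ρ t v) (ρ t w) = inner ℂ v w
  continuous : ∀ v : V, Continuous fun t : T => ρ t v

namespace UnitaryRep

attribute [instance] normed innerProduct finiteDimensional

section Basic

variable {T : Type u} [Group T] [TopologicalSpace T]

/-- The space of intertwiners. -/
def homSpace (X Y : UnitaryRep T) : Submodule ℂ (X.V →ₗ[ℂ] Y.V) where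
  carrier := {f | ∀ t v, f (X.ρ t v) = Y.ρ t (f v)}
  add_mem' hf hg t v := by simp [hf t v, hg t v]
  zero_mem' t v := by simp
  smul_mem' c f hf t v := by simp [hf t v]

theorem rho_inv_apply (X : UnitaryRep T) (t : T) (v : X.V) : X.ρ t⁻¹ (X.ρ t v) = v := by
  rw [← Module.End.mul_apply, ← map_mul]
  simp

theorem rho_apply_inv (X : UnitaryRep T) (t : T) (v : X.V) : X.ρ t (X.ρ t⁻¹ v) = v := by
  rw [← Module.End.mul_apply, ← map_mul]
  simp

theorem inner_rho_left (X : UnitaryRep T) (t : T) (v w : X.V) :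
    inner ℂ (X.ρ t v) w = inner ℂ v (X.ρ t⁻¹ w) := by
  rw [← X.inner_map t v, rho_apply_inv]

/-- Morphisms of representations are the intertwining linear maps. -/
instance : Category.{0} (UnitaryRep T) where
  Hom X Y := homSpace X Y
  id X := ⟨LinearMap.id, fun _ _ => rfl⟩
  comp f g := ⟨g.1 ∘ₗ f.1, fun t v => by
    rw [LinearMap.comp_apply, f.2 t v, g.2 t, LinearMap.comp_apply]⟩

instance : Preadditive (UnitaryRep T) where
  homGroup X Y := inferInstanceAs (AddCommGroup (homSpace X Y))
  add_comp _ _ _ f f' g := Subtype.ext (LinearMap.comp_add f.1 f'.1 g.1)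
  comp_add _ _ _ f g g' := Subtype.ext (LinearMap.add_comp f.1 g'.1 g.1)

instance : Linear ℂ (UnitaryRep T) where
  homModule X Y := inferInstanceAs (Module ℂ (homSpace X Y))
  smul_comp _ _ _ c f g := Subtype.ext (LinearMap.comp_smul g.1 c f.1)
  comp_smul _ _ _ f c g := Subtype.ext (LinearMap.smul_comp c g.1 f.1)

theorem adjoint_mem {X Y : UnitaryRep T} (f : X ⟶ Y) :
    LinearMap.adjoint f.1 ∈ homSpace Y X := by
  intro t w
  refine ext_inner_left ℂ fun v => ?_
  rw [LinearMap.adjoint_inner_right, ← inner_conj_symm, inner_rho_left, inner_conj_symm,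
    ← f.2, ← LinearMap.adjoint_inner_right, ← inner_conj_symm, ← inner_conj_symm v,
    inner_rho_left]

/-- The inner product on intertwiners is `⟪f, g⟫ = tr (f* g)`, and `f*` is the Hilbert space
adjoint. -/
noncomputable instance : HStarCategory (UnitaryRep T) where
  homInner X Y := hilbSchmidtCore (homSpace X Y)
  finite X Y := inferInstanceAs (Module.Finite ℂ (homSpace X Y))
  dagger f := ⟨LinearMap.adjoint f.1, adjoint_mem f⟩
  dagger_add f g := Subtype.ext (map_add LinearMap.adjoint f.1 g.1)
  dagger_smul c f := Subtype.ext (adjoint_smul_complex c f.1)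
  dagger_dagger f := Subtype.ext (LinearMap.adjoint_adjoint f.1)
  dagger_comp f g := Subtype.ext (adjoint_comp_complex f.1 g.1)
  inner_comp_left f g h := hilbSchmidt_comp_left f.1 g.1 h.1
  inner_comp_right f g h := hilbSchmidt_comp_right f.1 g.1 h.1

/-- A linear equivalence that intertwines is an isomorphism. -/
def mkIso {X Y : UnitaryRep T} (e : X.V ≃ₗ[ℂ] Y.V) (h : ∀ t v, e (X.ρ t v) = Y.ρ t (e v)) :
    X ≅ Y where
  hom := ⟨e.toLinearMap, h⟩
  inv := ⟨e.symm.toLinearMap, fun t w => by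
    change e.symm (Y.ρ t w) = X.ρ t (e.symm w)
    rw [LinearEquiv.symm_apply_eq, h, LinearEquiv.apply_symm_apply]⟩
  hom_inv_id := Subtype.ext (LinearMap.ext e.symm_apply_apply)
  inv_hom_id := Subtype.ext (LinearMap.ext e.apply_symm_apply)

/-- The tensor product of representations: the Hilbert space tensor product with `T` acting by
`t (v ⊗ w) = t v ⊗ t w`. -/
noncomputable def tensor (X Y : UnitaryRep T) : UnitaryRep T where
  V := TensorProduct ℂ X.V Y.V
  ρ := X.ρ.tprod Y.ρ
  inner_map t v w := by
    change inner ℂ (TensorProduct.map (X.ρ t) (Y.ρ t) v) (TensorProduct.map (X.ρ t) (Y.ρ t) w) = _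
    induction v with
    | zero => simp
    | add v v' hv hv' => simp only [map_add, inner_add_left, hv, hv']
    | tmul a b =>
      induction w with
      | zero => simp
      | add w w' hw hw' => simp only [map_add, inner_add_right, hw, hw']
      | tmul c d => simp [X.inner_map, Y.inner_map]
  continuous v := by
    change Continuous fun t => TensorProduct.map (X.ρ t) (Y.ρ t) v
    induction v with
    | zero => simpa using continuous_const
    | add v v' hv hv' =>
      simp only [map_add]
      exact hv.add hv'
    | tmul a b =>
      simp only [TensorProduct.map_tmul]
      exact TensorProduct.continuous_tmul.comp ((X.continuous a).prodMk (Y.continuous b))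

/-- The trivial one-dimensional representation. -/
noncomputable def trivialRep (T : Type u) [Group T] [TopologicalSpace T] : UnitaryRep T where
  V := ℂ
  ρ := 1
  inner_map _ _ _ := rfl
  continuous _ := continuous_const

theorem map_mem_homSpace {X X' Y Y' : UnitaryRep T} (f : X ⟶ X') (g : Y ⟶ Y') :
    TensorProduct.map f.1 g.1 ∈ homSpace (tensor X Y) (tensor X' Y') := by
  intro t (v : TensorProduct ℂ X.V Y.V)
  change TensorProduct.map f.1 g.1 (TensorProduct.map (X.ρ t) (Y.ρ t) v) =
    TensorProduct.map (X'.ρ t) (Y'.ρ t) (TensorProduct.map f.1 g.1 v)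
  induction v with
  | zero => simp
  | add v v' hv hv' => simp only [map_add, hv, hv']
  | tmul a b => simp only [TensorProduct.map_tmul, f.2 t a, g.2 t b]

theorem ext_linear {X Y : UnitaryRep T} {f g : X ⟶ Y} (h : ∀ v, f.1 v = g.1 v) : f = g :=
  Subtype.ext (LinearMap.ext h)

/-- The usual tensor product of representations, with the associator
`(x ⊗ y) ⊗ z ↦ x ⊗ (y ⊗ z)` and the unit laws `1 ⊗ x ↦ x`, `x ⊗ 1 ↦ x`. -/
noncomputable instance : MonoidalCategoryStruct (UnitaryRep T) where
  tensorObj := tensor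
  tensorUnit := trivialRep T
  tensorHom f g := ⟨TensorProduct.map f.1 g.1, map_mem_homSpace f g⟩
  whiskerLeft X _ _ g := ⟨TensorProduct.map LinearMap.id g.1, map_mem_homSpace (𝟙 X) g⟩
  whiskerRight f Y := ⟨TensorProduct.map f.1 LinearMap.id, map_mem_homSpace f (𝟙 Y)⟩
  associator X Y Z := mkIso (X := tensor (tensor X Y) Z) (Y := tensor X (tensor Y Z))
    (TensorProduct.assoc ℂ X.V Y.V Z.V) fun t v => LinearMap.congr_fun
      (TensorProduct.ext_threefold (g := (TensorProduct.assoc ℂ X.V Y.V Z.V).toLinearMap ∘ₗ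
        (tensor (tensor X Y) Z).ρ t) (h := (tensor X (tensor Y Z)).ρ t ∘ₗ
          (TensorProduct.assoc ℂ X.V Y.V Z.V).toLinearMap) fun _ _ _ => rfl) v
  leftUnitor X := mkIso (X := tensor (trivialRep T) X) (TensorProduct.lid ℂ X.V) fun t v =>
    LinearMap.congr_fun (TensorProduct.ext' (g := (TensorProduct.lid ℂ X.V).toLinearMap ∘ₗ
        (tensor (trivialRep T) X).ρ t) (h := X.ρ t ∘ₗ (TensorProduct.lid ℂ X.V).toLinearMap)
          fun c v => ((X.ρ t).map_smul c v).symm) v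
  rightUnitor X := mkIso (X := tensor X (trivialRep T)) (TensorProduct.rid ℂ X.V) fun t v =>
    LinearMap.congr_fun (TensorProduct.ext' (g := (TensorProduct.rid ℂ X.V).toLinearMap ∘ₗ
        (tensor X (trivialRep T)).ρ t) (h := X.ρ t ∘ₗ (TensorProduct.rid ℂ X.V).toLinearMap)
          fun v c => ((X.ρ t).map_smul c v).symm) v

theorem hom_ext_two {X Y Z : UnitaryRep T} {f g : X ⊗ Y ⟶ Z}
    (h : ∀ (v : X.V) (w : Y.V), f.1 (v ⊗ₜ[ℂ] w) = g.1 (v ⊗ₜ[ℂ] w)) : f = g :=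
  Subtype.ext (TensorProduct.ext' (M := X.V) (N := Y.V) h)

theorem hom_ext_three {X Y Z W : UnitaryRep T} {f g : (X ⊗ Y) ⊗ Z ⟶ W}
    (h : ∀ (a : X.V) (b : Y.V) (c : Z.V), f.1 ((a ⊗ₜ[ℂ] b) ⊗ₜ[ℂ] c) = g.1 ((a ⊗ₜ[ℂ] b) ⊗ₜ[ℂ] c)) :
    f = g :=
  Subtype.ext (TensorProduct.ext_threefold (M := X.V) (N := Y.V) (P := Z.V) h)

theorem hom_ext_three' {X Y Z W : UnitaryRep T} {f g : X ⊗ Y ⊗ Z ⟶ W}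
    (h : ∀ (a : X.V) (b : Y.V) (c : Z.V), f.1 (a ⊗ₜ[ℂ] (b ⊗ₜ[ℂ] c)) = g.1 (a ⊗ₜ[ℂ] (b ⊗ₜ[ℂ] c))) :
    f = g :=
  Subtype.ext (TensorProduct.ext_threefold' (M := X.V) (N := Y.V) (P := Z.V) h)

theorem hom_ext_four {X Y Z W U : UnitaryRep T} {f g : ((X ⊗ Y) ⊗ Z) ⊗ W ⟶ U}
    (h : ∀ (a : X.V) (b : Y.V) (c : Z.V) (d : W.V),
      f.1 (((a ⊗ₜ[ℂ] b) ⊗ₜ[ℂ] c) ⊗ₜ[ℂ] d) = g.1 (((a ⊗ₜ[ℂ] b) ⊗ₜ[ℂ] c) ⊗ₜ[ℂ] d)) : f = g :=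
  Subtype.ext (TensorProduct.ext_fourfold (M := X.V) (N := Y.V) (P := Z.V) (Q := W.V) h)

noncomputable instance : MonoidalCategory (UnitaryRep T) where
  tensorHom_def _ _ := hom_ext_two fun _ _ => rfl
  id_tensorHom_id _ _ := hom_ext_two fun _ _ => rfl
  tensorHom_comp_tensorHom _ _ _ _ := hom_ext_two fun _ _ => rfl
  whiskerLeft_id _ _ := hom_ext_two fun _ _ => rfl
  id_whiskerRight _ _ := hom_ext_two fun _ _ => rfl
  associator_naturality _ _ _ := hom_ext_three fun _ _ _ => rfl
  leftUnitor_naturality f := hom_ext_two fun (c : ℂ) v => (f.1.map_smul c v).symm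
  rightUnitor_naturality f := hom_ext_two fun v (c : ℂ) => (f.1.map_smul c v).symm
  pentagon _ _ _ _ := hom_ext_four fun _ _ _ _ => rfl
  triangle _ _ := hom_ext_three fun v (c : ℂ) w => TensorProduct.tmul_smul c v w

/-- The symmetry `v ⊗ w ↦ w ⊗ v`. -/
noncomputable instance : SymmetricCategory (UnitaryRep T) where
  braiding X Y := mkIso (X := tensor X Y) (Y := tensor Y X) (TensorProduct.comm ℂ X.V Y.V)
    fun t v => LinearMap.congr_fun (TensorProduct.ext'
      (g := (TensorProduct.comm ℂ X.V Y.V).toLinearMap ∘ₗ (tensor X Y).ρ t)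
      (h := (tensor Y X).ρ t ∘ₗ (TensorProduct.comm ℂ X.V Y.V).toLinearMap) fun _ _ => rfl) v
  braiding_naturality_right _ _ _ _ := hom_ext_two fun _ _ => rfl
  braiding_naturality_left _ _ := hom_ext_two fun _ _ => rfl
  hexagon_forward _ _ _ := hom_ext_three fun _ _ _ => rfl
  hexagon_reverse _ _ _ := hom_ext_three' fun _ _ _ => rfl
  symmetry _ _ := hom_ext_two fun _ _ => rfl

end Basic

end UnitaryRep

/-! ## The category `Hilb[G]` -/

/-- A `G`-graded Hilbert space of finite total dimension: a finite-dimensional Hilbert space which is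
the orthogonal direct sum of subspaces `grade g`, `g ∈ G`. -/
structure GradedHilb (G : Type u) where
  V : Type
  [normed : NormedAddCommGroup V]
  [innerProduct : InnerProductSpace ℂ V]
  [finiteDimensional : FiniteDimensional ℂ V]
  grade : G → Submodule ℂ V
  orthogonal : ∀ g h : G, g ≠ h → grade g ⟂ grade h
  iSup_grade : ⨆ g, grade g = ⊤

namespace GradedHilb

attribute [instance] normed innerProduct finiteDimensional

section Basic

variable {G : Type u}

/-- The space of grading-preserving linear maps. -/
def homSpace (X Y : GradedHilb G) : Submodule ℂ (X.V →ₗ[ℂ] Y.V) where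
  carrier := {f | ∀ g, ∀ v ∈ X.grade g, f v ∈ Y.grade g}
  add_mem' hf hk g v hv := (Y.grade g).add_mem (hf g v hv) (hk g v hv)
  zero_mem' g _ _ := (Y.grade g).zero_mem
  smul_mem' c _ hf g v hv := (Y.grade g).smul_mem c (hf g v hv)

/-- Morphisms of graded Hilbert spaces are the linear maps preserving the grading. -/
instance : Category.{0} (GradedHilb G) where
  Hom X Y := homSpace X Y
  id X := ⟨LinearMap.id, fun _ _ hv => hv⟩
  comp f k := ⟨k.1 ∘ₗ f.1, fun g v hv => k.2 g _ (f.2 g v hv)⟩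

instance : Preadditive (GradedHilb G) where
  homGroup X Y := inferInstanceAs (AddCommGroup (homSpace X Y))
  add_comp _ _ _ f f' g := Subtype.ext (LinearMap.comp_add f.1 f'.1 g.1)
  comp_add _ _ _ f g g' := Subtype.ext (LinearMap.add_comp f.1 g'.1 g.1)

instance : Linear ℂ (GradedHilb G) where
  homModule X Y := inferInstanceAs (Module ℂ (homSpace X Y))
  smul_comp _ _ _ c f g := Subtype.ext (LinearMap.comp_smul g.1 c f.1)
  comp_smul _ _ _ f c g := Subtype.ext (LinearMap.smul_comp c g.1 f.1)

theorem mem_grade_of_inner_eq_zero (X : GradedHilb G) (g : G) (w : X.V)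
    (hw : ∀ h, h ≠ g → ∀ v ∈ X.grade h, inner ℂ v w = 0) : w ∈ X.grade g := by
  have key : w - (X.grade g).starProjection w = 0 := by
    have hperp : w - (X.grade g).starProjection w ∈ (⨆ h, X.grade h)ᗮ := by
      rw [← Submodule.iInf_orthogonal, Submodule.mem_iInf]
      intro h
      rw [Submodule.mem_orthogonal]
      intro v hv
      by_cases hg : h = g
      · subst hg
        exact (Submodule.mem_orthogonal _ _).1
          (Submodule.sub_starProjection_mem_orthogonal w) v hv
      · rw [inner_sub_right, hw h hg v hv, zero_sub, neg_eq_zero]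
        exact (Submodule.isOrtho_iff_inner_eq.1 (X.orthogonal h g hg)) v hv _
          (Submodule.starProjection_apply_mem _ w)
    rw [X.iSup_grade, Submodule.top_orthogonal_eq_bot] at hperp
    exact (Submodule.mem_bot ℂ).1 hperp
  rw [sub_eq_zero.1 key]
  exact Submodule.starProjection_apply_mem _ w

theorem adjoint_mem {X Y : GradedHilb G} (f : X ⟶ Y) :
    LinearMap.adjoint f.1 ∈ homSpace Y X := by
  intro g w hw
  refine X.mem_grade_of_inner_eq_zero g _ fun h hg v hv => ?_
  rw [LinearMap.adjoint_inner_right]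
  exact (Submodule.isOrtho_iff_inner_eq.1 (Y.orthogonal h g hg)) _ (f.2 h v hv) _ hw

/-- The inner product on morphisms is `⟪f, g⟫ = tr (f* g)`, and `f*` is the Hilbert space
adjoint. -/
noncomputable instance : HStarCategory (GradedHilb G) where
  homInner X Y := hilbSchmidtCore (homSpace X Y)
  finite X Y := inferInstanceAs (Module.Finite ℂ (homSpace X Y))
  dagger f := ⟨LinearMap.adjoint f.1, adjoint_mem f⟩
  dagger_add f g := Subtype.ext (map_add LinearMap.adjoint f.1 g.1)
  dagger_smul c f := Subtype.ext (adjoint_smul_complex c f.1)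
  dagger_dagger f := Subtype.ext (LinearMap.adjoint_adjoint f.1)
  dagger_comp f g := Subtype.ext (adjoint_comp_complex f.1 g.1)
  inner_comp_left f g h := hilbSchmidt_comp_left f.1 g.1 h.1
  inner_comp_right f g h := hilbSchmidt_comp_right f.1 g.1 h.1

/-- A linear equivalence preserving the grading in both directions is an isomorphism. -/
def mkIso {X Y : GradedHilb G} (e : X.V ≃ₗ[ℂ] Y.V) (h : ∀ g, ∀ v ∈ X.grade g, e v ∈ Y.grade g)
    (h' : ∀ g, ∀ v ∈ Y.grade g, e.symm v ∈ X.grade g) : X ≅ Y where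
  hom := ⟨e.toLinearMap, h⟩
  inv := ⟨e.symm.toLinearMap, h'⟩
  hom_inv_id := Subtype.ext (LinearMap.ext e.symm_apply_apply)
  inv_hom_id := Subtype.ext (LinearMap.ext e.apply_symm_apply)

end Basic

section Monoidal

variable {G : Type u} [Group G]

/-- The convolution grading: `(x ⊗ y)(g)` is the sum of the subspaces `x(g') ⊗ y(g'')` of `x ⊗ y`
over all `g'`, `g''` with `g' g'' = g`. -/
def tensorGrade (X Y : GradedHilb G) (g : G) : Submodule ℂ (X.V ⊗[ℂ] Y.V) :=
  ⨆ p : {p : G × G // p.1 * p.2 = g},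
    Submodule.map₂ (TensorProduct.mk ℂ X.V Y.V) (X.grade p.1.1) (Y.grade p.1.2)

theorem tmul_mem_tensorGrade {X Y : GradedHilb G} {a b g : G} (h : a * b = g) {v : X.V} {w : Y.V}
    (hv : v ∈ X.grade a) (hw : w ∈ Y.grade b) : v ⊗ₜ[ℂ] w ∈ tensorGrade X Y g :=
  Submodule.mem_iSup_of_mem (⟨(a, b), h⟩ : {p : G × G // p.1 * p.2 = g})
    (Submodule.apply_mem_map₂ (TensorProduct.mk ℂ X.V Y.V) hv hw)

theorem tensorGrade_le {X Y : GradedHilb G} {g : G} {S : Submodule ℂ (X.V ⊗[ℂ] Y.V)}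
    (h : ∀ a b, a * b = g → ∀ v ∈ X.grade a, ∀ w ∈ Y.grade b, v ⊗ₜ[ℂ] w ∈ S) :
    tensorGrade X Y g ≤ S :=
  iSup_le fun p => Submodule.map₂_le.2 fun v hv w hw => h _ _ p.2 v hv w hw

/-- The convolution tensor product of graded Hilbert spaces. -/
noncomputable def tensor (X Y : GradedHilb G) : GradedHilb G where
  V := X.V ⊗[ℂ] Y.V
  grade := tensorGrade X Y
  orthogonal g h hgh := by
    refine tensorGrade_le fun a b hab v hv w hw => ?_
    rw [Submodule.mem_orthogonal]
    intro z hz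
    have hle : tensorGrade X Y h ≤ (ℂ ∙ (v ⊗ₜ[ℂ] w))ᗮ := by
      refine tensorGrade_le fun a' b' hab' v' hv' w' hw' => ?_
      rw [Submodule.mem_orthogonal_singleton_iff_inner_right, TensorProduct.inner_tmul]
      by_cases ha : a = a'
      · have hb : b ≠ b' := by
          rintro rfl
          exact hgh (by rw [← hab, ← hab', ha])
        rw [(Submodule.isOrtho_iff_inner_eq.1 (Y.orthogonal b b' hb)) w hw w' hw', mul_zero]
      · rw [(Submodule.isOrtho_iff_inner_eq.1 (X.orthogonal a a' ha)) v hv v' hv', zero_mul]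
    exact (Submodule.mem_orthogonal_singleton_iff_inner_left).1 (hle hz)
  iSup_grade := by
    rw [eq_top_iff, ← TensorProduct.map₂_mk_top_top_eq_top, ← X.iSup_grade, ← Y.iSup_grade,
      Submodule.map₂_iSup_left]
    refine iSup_le fun a => ?_
    rw [Submodule.map₂_iSup_right]
    refine iSup_le fun b => Submodule.map₂_le.2 fun v hv w hw => ?_
    exact Submodule.mem_iSup_of_mem (a * b) (tmul_mem_tensorGrade rfl hv hw)

/-- The unit of convolution: the Hilbert space `ℂ`, concentrated in degree `1`. -/
noncomputable def unitObj (G : Type u) [Group G] : GradedHilb G where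
  V := ℂ
  grade g := ⨆ _ : g = 1, ⊤
  orthogonal g h hgh := by
    by_cases hg : g = 1
    · have hh : h ≠ 1 := fun hh => hgh (hg.trans hh.symm)
      simp [hh]
    · simp [hg]
  iSup_grade := by simp

theorem one_mem_unitObj (c : ℂ) : (c : (unitObj G).V) ∈ (unitObj G).grade 1 :=
  Submodule.mem_iSup_of_mem rfl trivial

theorem map_mem_homSpace {X X' Y Y' : GradedHilb G} (f : X ⟶ X') (k : Y ⟶ Y') :
    TensorProduct.map f.1 k.1 ∈ homSpace (tensor X Y) (tensor X' Y') := fun g =>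
  tensorGrade_le (S := (tensorGrade X' Y' g).comap (TensorProduct.map f.1 k.1))
    fun a b hab v hv w hw => tmul_mem_tensorGrade hab (f.2 a v hv) (k.2 b w hw)

theorem assoc_mem (X Y Z : GradedHilb G) (g : G) : ∀ v ∈ tensorGrade (tensor X Y) Z g,
    TensorProduct.assoc ℂ X.V Y.V Z.V v ∈ tensorGrade X (tensor Y Z) g := by
  refine tensorGrade_le (X := tensor X Y) (S := (tensorGrade X (tensor Y Z) g).comap
    (TensorProduct.assoc ℂ X.V Y.V Z.V).toLinearMap) fun a b hab v hv w hw => ?_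
  revert v
  refine tensorGrade_le (S := ((tensorGrade X (tensor Y Z) g).comap
    (TensorProduct.assoc ℂ X.V Y.V Z.V).toLinearMap).comap
      ((TensorProduct.mk ℂ (X.V ⊗[ℂ] Y.V) Z.V).flip w)) fun c d hcd x hx y hy => ?_
  exact tmul_mem_tensorGrade (X := X) (Y := tensor Y Z) (a := c) (b := d * b)
    (by rw [← mul_assoc, hcd, hab]) hx (tmul_mem_tensorGrade rfl hy hw)

theorem assoc_symm_mem (X Y Z : GradedHilb G) (g : G) : ∀ v ∈ tensorGrade X (tensor Y Z) g,
    (TensorProduct.assoc ℂ X.V Y.V Z.V).symm v ∈ tensorGrade (tensor X Y) Z g := by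
  refine tensorGrade_le (Y := tensor Y Z) (S := (tensorGrade (tensor X Y) Z g).comap
    (TensorProduct.assoc ℂ X.V Y.V Z.V).symm.toLinearMap) fun a b hab v hv w hw => ?_
  revert w
  refine tensorGrade_le (S := ((tensorGrade (tensor X Y) Z g).comap
    (TensorProduct.assoc ℂ X.V Y.V Z.V).symm.toLinearMap).comap
      (TensorProduct.mk ℂ X.V (Y.V ⊗[ℂ] Z.V) v)) fun c d hcd x hx y hy => ?_
  exact tmul_mem_tensorGrade (X := tensor X Y) (Y := Z) (a := a * c) (b := d)
    (by rw [mul_assoc, hcd, hab]) (tmul_mem_tensorGrade rfl hv hx) hy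

theorem eq_one_of_mem_unitObj {a : G} {c : ℂ} (hc : (c : (unitObj G).V) ∈ (unitObj G).grade a)
    (h : c ≠ 0) : a = 1 := by
  by_contra ha
  change c ∈ (⨆ _ : a = 1, (⊤ : Submodule ℂ ℂ)) at hc
  simp [ha] at hc
  exact h hc

theorem lid_mem (X : GradedHilb G) (g : G) : ∀ v ∈ tensorGrade (unitObj G) X g,
    TensorProduct.lid ℂ X.V v ∈ X.grade g := by
  refine tensorGrade_le (X := unitObj G) (S := (X.grade g).comap
    (TensorProduct.lid ℂ X.V).toLinearMap) fun a b hab (c : ℂ) hc w hw => ?_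
  change c • w ∈ X.grade g
  by_cases h0 : c = 0
  · simp [h0]
  · rw [eq_one_of_mem_unitObj hc h0, one_mul] at hab
    exact hab ▸ (X.grade b).smul_mem c hw

theorem rid_mem (X : GradedHilb G) (g : G) : ∀ v ∈ tensorGrade X (unitObj G) g,
    TensorProduct.rid ℂ X.V v ∈ X.grade g := by
  refine tensorGrade_le (Y := unitObj G) (S := (X.grade g).comap
    (TensorProduct.rid ℂ X.V).toLinearMap) fun a b hab w hw (c : ℂ) hc => ?_
  change c • w ∈ X.grade g
  by_cases h0 : c = 0
  · simp [h0]
  · rw [eq_one_of_mem_unitObj hc h0, mul_one] at hab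
    exact hab ▸ (X.grade a).smul_mem c hw

/-- The convolution tensor product on `Hilb[G]`, with the associator
`(x ⊗ y) ⊗ z ↦ x ⊗ (y ⊗ z)` and the unit laws `1 ⊗ x ↦ x`, `x ⊗ 1 ↦ x`. -/
noncomputable instance : MonoidalCategoryStruct (GradedHilb G) where
  tensorObj := tensor
  tensorUnit := unitObj G
  tensorHom f k := ⟨TensorProduct.map f.1 k.1, map_mem_homSpace f k⟩
  whiskerLeft X _ _ k := ⟨TensorProduct.map LinearMap.id k.1, map_mem_homSpace (𝟙 X) k⟩
  whiskerRight f Y := ⟨TensorProduct.map f.1 LinearMap.id, map_mem_homSpace f (𝟙 Y)⟩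
  associator X Y Z := mkIso (X := tensor (tensor X Y) Z) (Y := tensor X (tensor Y Z))
    (TensorProduct.assoc ℂ X.V Y.V Z.V) (assoc_mem X Y Z) (assoc_symm_mem X Y Z)
  leftUnitor X := mkIso (X := tensor (unitObj G) X) (TensorProduct.lid ℂ X.V) (lid_mem X)
    fun g _ hv => tmul_mem_tensorGrade (X := unitObj G) (one_mul g) (one_mem_unitObj 1) hv
  rightUnitor X := mkIso (X := tensor X (unitObj G)) (TensorProduct.rid ℂ X.V) (rid_mem X)
    fun g _ hv => tmul_mem_tensorGrade (Y := unitObj G) (mul_one g) hv (one_mem_unitObj 1)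

theorem hom_ext_two {X Y Z : GradedHilb G} {f g : X ⊗ Y ⟶ Z}
    (h : ∀ (v : X.V) (w : Y.V), f.1 (v ⊗ₜ[ℂ] w) = g.1 (v ⊗ₜ[ℂ] w)) : f = g :=
  Subtype.ext (TensorProduct.ext' (M := X.V) (N := Y.V) h)

theorem hom_ext_three {X Y Z W : GradedHilb G} {f g : (X ⊗ Y) ⊗ Z ⟶ W}
    (h : ∀ (a : X.V) (b : Y.V) (c : Z.V), f.1 ((a ⊗ₜ[ℂ] b) ⊗ₜ[ℂ] c) = g.1 ((a ⊗ₜ[ℂ] b) ⊗ₜ[ℂ] c)) :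
    f = g :=
  Subtype.ext (TensorProduct.ext_threefold (M := X.V) (N := Y.V) (P := Z.V) h)

theorem hom_ext_three' {X Y Z W : GradedHilb G} {f g : X ⊗ Y ⊗ Z ⟶ W}
    (h : ∀ (a : X.V) (b : Y.V) (c : Z.V), f.1 (a ⊗ₜ[ℂ] (b ⊗ₜ[ℂ] c)) = g.1 (a ⊗ₜ[ℂ] (b ⊗ₜ[ℂ] c))) :
    f = g :=
  Subtype.ext (TensorProduct.ext_threefold' (M := X.V) (N := Y.V) (P := Z.V) h)

theorem hom_ext_four {X Y Z W U : GradedHilb G} {f g : ((X ⊗ Y) ⊗ Z) ⊗ W ⟶ U}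
    (h : ∀ (a : X.V) (b : Y.V) (c : Z.V) (d : W.V),
      f.1 (((a ⊗ₜ[ℂ] b) ⊗ₜ[ℂ] c) ⊗ₜ[ℂ] d) = g.1 (((a ⊗ₜ[ℂ] b) ⊗ₜ[ℂ] c) ⊗ₜ[ℂ] d)) : f = g :=
  Subtype.ext (TensorProduct.ext_fourfold (M := X.V) (N := Y.V) (P := Z.V) (Q := W.V) h)

noncomputable instance : MonoidalCategory (GradedHilb G) where
  tensorHom_def _ _ := hom_ext_two fun _ _ => rfl
  id_tensorHom_id _ _ := hom_ext_two fun _ _ => rfl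
  tensorHom_comp_tensorHom _ _ _ _ := hom_ext_two fun _ _ => rfl
  whiskerLeft_id _ _ := hom_ext_two fun _ _ => rfl
  id_whiskerRight _ _ := hom_ext_two fun _ _ => rfl
  associator_naturality _ _ _ := hom_ext_three fun _ _ _ => rfl
  leftUnitor_naturality f := hom_ext_two fun (c : ℂ) v => (f.1.map_smul c v).symm
  rightUnitor_naturality f := hom_ext_two fun v (c : ℂ) => (f.1.map_smul c v).symm
  pentagon _ _ _ _ := hom_ext_four fun _ _ _ _ => rfl
  triangle _ _ := hom_ext_three fun v (c : ℂ) w => TensorProduct.tmul_smul c v w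

end Monoidal

section Symmetric

variable {G : Type u} [CommGroup G]

theorem comm_mem (X Y : GradedHilb G) (g : G) : ∀ v ∈ tensorGrade X Y g,
    TensorProduct.comm ℂ X.V Y.V v ∈ tensorGrade Y X g :=
  tensorGrade_le (S := (tensorGrade Y X g).comap (TensorProduct.comm ℂ X.V Y.V).toLinearMap)
    fun a b hab _ hv _ hw => tmul_mem_tensorGrade ((mul_comm b a).trans hab) hw hv

/-- The symmetry `v ⊗ w ↦ w ⊗ v`. -/
noncomputable instance : SymmetricCategory (GradedHilb G) where
  braiding X Y := mkIso (X := tensor X Y) (Y := tensor Y X) (TensorProduct.comm ℂ X.V Y.V)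
    (comm_mem X Y) (comm_mem Y X)
  braiding_naturality_right _ _ _ _ := hom_ext_two fun _ _ => rfl
  braiding_naturality_left _ _ := hom_ext_two fun _ _ => rfl
  hexagon_forward _ _ _ := hom_ext_three fun _ _ _ => rfl
  hexagon_reverse _ _ _ := hom_ext_three' fun _ _ _ => rfl
  symmetry _ _ := hom_ext_two fun _ _ => rfl

end Symmetric

end GradedHilb

/-! ## The dual of a compact abelian group and the categorified Fourier transform -/

namespace UnitaryRep

section Irreducible

variable {T : Type u} [Group T] [TopologicalSpace T]

theorem isIrreducible_iff (X : UnitaryRep T) : X.ρ.IsIrreducible ↔ Nontrivial X.V ∧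
    ∀ W : Submodule ℂ X.V, (∀ t, ∀ v ∈ W, X.ρ t v ∈ W) → W = ⊥ ∨ W = ⊤ := by
  constructor
  · intro h
    refine ⟨?_, fun W hW => ?_⟩
    · by_contra hn
      rw [not_nontrivial_iff_subsingleton] at hn
      refine bot_ne_top (α := Subrepresentation X.ρ)
        (Subrepresentation.toSubmodule_injective (Subsingleton.elim _ _))
    · rcases h.eq_bot_or_eq_top (⟨W, fun t v hv => hW t v hv⟩ : Subrepresentation X.ρ) with h | h
      · exact Or.inl (congrArg Subrepresentation.toSubmodule h)
      · exact Or.inr (congrArg Subrepresentation.toSubmodule h)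
  · rintro ⟨hn, h⟩
    refine { exists_pair_ne := ⟨⊥, ⊤, fun hbt => ?_⟩, eq_bot_or_eq_top := fun W => ?_ }
    · exact bot_ne_top (α := Submodule ℂ X.V) (congrArg Subrepresentation.toSubmodule hbt)
    · rcases h W.toSubmodule (fun t v hv => W.apply_mem_toSubmodule t hv) with h | h
      · exact Or.inl (Subrepresentation.toSubmodule_injective h)
      · exact Or.inr (Subrepresentation.toSubmodule_injective h)

/-- The restriction of a representation to an invariant subspace. -/
noncomputable def sub (X : UnitaryRep T) (W : Submodule ℂ X.V)
    (hW : ∀ t, ∀ v ∈ W, X.ρ t v ∈ W) : UnitaryRep T where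
  V := W
  ρ :=
    { toFun := fun t => (X.ρ t).restrict (hW t)
      map_one' := by ext; simp
      map_mul' := fun s t => by ext; simp }
  inner_map t v w := X.inner_map t v w
  continuous v := (X.continuous v).subtype_mk _

theorem exists_irreducible_le (X : UnitaryRep T) (n : ℕ) : ∀ (W : Submodule ℂ X.V),
    (∀ t, ∀ v ∈ W, X.ρ t v ∈ W) → W ≠ ⊥ → Module.finrank ℂ W ≤ n →
    ∃ (W' : Submodule ℂ X.V) (hW' : ∀ t, ∀ v ∈ W', X.ρ t v ∈ W'), W' ≤ W ∧ W' ≠ ⊥ ∧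
      (X.sub W' hW').ρ.IsIrreducible := by
  induction n with
  | zero =>
    intro W _ hne hle
    exact absurd (Submodule.finrank_eq_zero.1 (Nat.le_zero.1 hle)) hne
  | succ n ih =>
    intro W hW hne hle
    by_cases hirr : (X.sub W hW).ρ.IsIrreducible
    · exact ⟨W, hW, le_rfl, hne, hirr⟩
    · rw [isIrreducible_iff] at hirr
      push Not at hirr
      obtain ⟨P, hP, hPb, hPt⟩ := hirr ((Submodule.nontrivial_iff_ne_bot).2 hne)
      change Submodule ℂ W at P
      have hPW : P.map W.subtype ≤ W := Submodule.map_subtype_le W P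
      obtain ⟨W', hW', h1, h2, h3⟩ := ih (P.map W.subtype)
        (by
          rintro t _ ⟨p, hp, rfl⟩
          exact ⟨_, hP t p hp, rfl⟩)
        (fun h => hPb (Submodule.map_injective_of_injective W.injective_subtype
          (h.trans (Submodule.map_bot W.subtype).symm)))
        (by
          rw [← Nat.lt_succ_iff]
          refine lt_of_lt_of_le (Submodule.finrank_lt_finrank_of_lt (lt_of_le_of_ne hPW ?_)) hle
          intro h
          refine hPt (Submodule.map_injective_of_injective W.injective_subtype ?_)
          exact h.trans W.map_subtype_top.symm)
      exact ⟨W', hW', h1.trans hPW, h2, h3⟩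

/-- The type of irreducible representations. -/
def Irrep (T : Type u) [Group T] [TopologicalSpace T] :=
  {X : UnitaryRep T // X.ρ.IsIrreducible}

instance irrepSetoid (T : Type u) [Group T] [TopologicalSpace T] : Setoid (Irrep T) where
  r X Y := Nonempty (X.1 ≅ Y.1)
  iseqv := ⟨fun X => ⟨Iso.refl X.1⟩, fun ⟨e⟩ => ⟨e.symm⟩, fun ⟨e⟩ ⟨e'⟩ => ⟨e ≪≫ e'⟩⟩

end Irreducible

end UnitaryRep

open UnitaryRep

/-- The dual `T̂`: the set of isomorphism classes of irreducible representations of `T`. -/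
def DualGroup (T : Type u) [Group T] [TopologicalSpace T] := Quotient (irrepSetoid T)

namespace UnitaryRep

section Isotypic

variable {T : Type u} [Group T] [TopologicalSpace T]

/-- The isotypic component `x(g)` of a representation `x`: the sum of all images of intertwiners to `x`
from irreducible representations in the class `g`. -/
def isotypic (X : UnitaryRep T) (g : DualGroup T) : Submodule ℂ X.V :=
  ⨆ (Y : Irrep T) (_ : (Quotient.mk _ Y : DualGroup T) = g) (f : Y.1 ⟶ X), LinearMap.range f.1

theorem isotypic_le {X : UnitaryRep T} {g : DualGroup T} {S : Submodule ℂ X.V}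
    (h : ∀ (Y : Irrep T) (_ : (Quotient.mk _ Y : DualGroup T) = g) (f : Y.1 ⟶ X) (v : Y.1.V),
      f.1 v ∈ S) : X.isotypic g ≤ S :=
  iSup_le fun Y => iSup_le fun hY => iSup_le fun f => by
    rintro _ ⟨v, rfl⟩
    exact h Y hY f v

theorem mem_isotypic {X : UnitaryRep T} {g : DualGroup T} (Y : Irrep T)
    (hY : (Quotient.mk _ Y : DualGroup T) = g) (f : Y.1 ⟶ X) (v : Y.1.V) :
    f.1 v ∈ X.isotypic g :=
  Submodule.mem_iSup_of_mem Y (Submodule.mem_iSup_of_mem hY (Submodule.mem_iSup_of_mem f ⟨v, rfl⟩))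

theorem isotypic_map {X X' : UnitaryRep T} (f : X ⟶ X') (g : DualGroup T) :
    ∀ v ∈ X.isotypic g, f.1 v ∈ X'.isotypic g :=
  isotypic_le (S := (X'.isotypic g).comap f.1) fun Y hY k v => mem_isotypic Y hY (k ≫ f) v

theorem isotypic_invariant (X : UnitaryRep T) (g : DualGroup T) (t : T) :
    ∀ v ∈ X.isotypic g, X.ρ t v ∈ X.isotypic g :=
  isotypic_le (S := (X.isotypic g).comap (X.ρ t)) fun Y hY k v => by
    change X.ρ t (k.1 v) ∈ X.isotypic g
    rw [← k.2 t v]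
    exact mem_isotypic Y hY k _

theorem schur {X Y : UnitaryRep T} (hX : X.ρ.IsIrreducible) (hY : Y.ρ.IsIrreducible) (f : X ⟶ Y)
    (hf : f.1 ≠ 0) : Nonempty (X ≅ Y) := by
  rw [isIrreducible_iff] at hX hY
  have hker : LinearMap.ker f.1 = ⊥ := by
    refine (hX.2 _ fun t v hv => ?_).resolve_right fun h => hf (LinearMap.ker_eq_top.1 h)
    rw [LinearMap.mem_ker] at hv ⊢
    rw [f.2, hv, map_zero]
  have hran : LinearMap.range f.1 = ⊤ := by
    refine (hY.2 _ fun t v hv => ?_).resolve_left fun h => hf (LinearMap.range_eq_bot.1 h)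
    obtain ⟨w, rfl⟩ := hv
    exact ⟨X.ρ t w, f.2 t w⟩
  exact ⟨mkIso (LinearEquiv.ofBijective f.1 ⟨LinearMap.ker_eq_bot.1 hker,
    LinearMap.range_eq_top.1 hran⟩) f.2⟩

theorem isotypic_orthogonal (X : UnitaryRep T) (g h : DualGroup T) (hgh : g ≠ h) :
    X.isotypic g ⟂ X.isotypic h := by
  refine isotypic_le (X := X) (S := (X.isotypic h)ᗮ) fun Y hY f v => ?_
  rw [Submodule.mem_orthogonal]
  intro w hw
  have hle : X.isotypic h ≤ (Submodule.span ℂ {(f.1 v : X.V)})ᗮ := by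
    refine isotypic_le (S := (Submodule.span ℂ {(f.1 v : X.V)})ᗮ) fun Z hZ k z => ?_
    rw [Submodule.mem_orthogonal_singleton_iff_inner_left]
    have h0 : (f ≫ HStarCategory.dagger k).1 = 0 := by
      by_contra hne
      exact hgh (hY.symm.trans ((Quotient.sound (schur Y.2 Z.2 _ hne)).trans hZ))
    have h1 : LinearMap.adjoint k.1 (f.1 v) = 0 := LinearMap.congr_fun h0 v
    rw [← LinearMap.adjoint_inner_right, h1, inner_zero_right]
  exact Submodule.mem_orthogonal_singleton_iff_inner_left.1 (hle hw)

theorem iSup_isotypic (X : UnitaryRep T) : ⨆ g, X.isotypic g = ⊤ := by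
  by_contra hne
  have hb : (⨆ g, X.isotypic g)ᗮ ≠ ⊥ := fun h => hne (Submodule.orthogonal_eq_bot_iff.1 h)
  have hinv : ∀ t, ∀ v ∈ ⨆ g, X.isotypic g, X.ρ t v ∈ ⨆ g, X.isotypic g := by
    intro t
    change (⨆ g, X.isotypic g) ≤ (⨆ g, X.isotypic g).comap (X.ρ t)
    exact iSup_le fun g v hv => Submodule.mem_iSup_of_mem g (X.isotypic_invariant g t v hv)
  obtain ⟨W, hW, hle, hWb, hirr⟩ := X.exists_irreducible_le _ (⨆ g, X.isotypic g)ᗮ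
    (by
      intro t v hv
      rw [Submodule.mem_orthogonal'] at hv ⊢
      intro w hw
      rw [inner_rho_left]
      exact hv _ (hinv _ w hw)) hb le_rfl
  refine hWb ((Submodule.eq_bot_iff W).2 fun w hw => ?_)
  have hmem : w ∈ ⨆ g, X.isotypic g :=
    Submodule.mem_iSup_of_mem (Quotient.mk _ ⟨X.sub W hW, hirr⟩ : DualGroup T)
      (mem_isotypic ⟨X.sub W hW, hirr⟩ rfl (⟨W.subtype, fun _ _ => rfl⟩ : X.sub W hW ⟶ X) ⟨w, hw⟩)
  exact inner_self_eq_zero.1 ((Submodule.mem_orthogonal _ _).1 (hle hw) w hmem)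

end Isotypic

section Abelian

variable {T : Type u} [CommGroup T] [TopologicalSpace T]

theorem exists_scalar {X : UnitaryRep T} (hX : X.ρ.IsIrreducible) (t : T) :
    ∃ c : ℂ, ∀ v, X.ρ t v = c • v := by
  rw [isIrreducible_iff] at hX
  have := hX.1
  obtain ⟨c, hc⟩ := Module.End.exists_eigenvalue (X.ρ t)
  refine ⟨c, fun v => ?_⟩
  have htop := (hX.2 (Module.End.eigenspace (X.ρ t) c) fun s v hv => by
    rw [Module.End.mem_eigenspace_iff] at hv ⊢
    rw [← Module.End.mul_apply, ← map_mul, mul_comm, map_mul, Module.End.mul_apply, hv,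
      map_smul]).resolve_left hc
  exact Module.End.mem_eigenspace_iff.1 (htop ▸ Submodule.mem_top)

theorem finrank_irreducible {X : UnitaryRep T} (hX : X.ρ.IsIrreducible) :
    Module.finrank ℂ X.V = 1 := by
  have hX' := (isIrreducible_iff X).1 hX
  have := hX'.1
  obtain ⟨v, hv⟩ := exists_ne (0 : X.V)
  refine finrank_eq_one v hv fun w => ?_
  have htop := (hX'.2 (ℂ ∙ v) fun t w hw => by
    obtain ⟨c, hc⟩ := exists_scalar hX t
    rw [hc]
    exact Submodule.smul_mem _ c hw).resolve_left
      (fun h => hv (Submodule.span_singleton_eq_bot.1 h))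
  exact Submodule.mem_span_singleton.1 (htop ▸ Submodule.mem_top)

theorem isIrreducible_of_finrank {X : UnitaryRep T} (h : Module.finrank ℂ X.V = 1) :
    X.ρ.IsIrreducible := by
  have := is_simple_module_of_finrank_eq_one (A := ℂ) h
  exact (isIrreducible_iff X).2 ⟨Module.nontrivial_of_finrank_pos (R := ℂ) (by omega),
    fun W _ => eq_bot_or_eq_top W⟩

theorem isIrreducible_tensor {X Y : UnitaryRep T} (hX : X.ρ.IsIrreducible)
    (hY : Y.ρ.IsIrreducible) : (X ⊗ Y).ρ.IsIrreducible := by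
  refine isIrreducible_of_finrank ?_
  change Module.finrank ℂ (X.V ⊗[ℂ] Y.V) = 1
  rw [Module.finrank_tensorProduct, finrank_irreducible hX, finrank_irreducible hY]

theorem isIrreducible_unit : (𝟙_ (UnitaryRep T)).ρ.IsIrreducible :=
  isIrreducible_of_finrank (Module.finrank_self ℂ)

theorem map_rho_inv_rho {X : UnitaryRep T} (hX : X.ρ.IsIrreducible) (t : T) (v : X.V ⊗[ℂ] X.V) :
    TensorProduct.map (X.ρ t⁻¹) (X.ρ t) v = v := by
  obtain ⟨c, hc⟩ := exists_scalar hX t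
  induction v with
  | zero => simp
  | add v w hv hw => rw [map_add, hv, hw]
  | tmul a b =>
    rw [TensorProduct.map_tmul, hc b, TensorProduct.tmul_smul, TensorProduct.smul_tmul', ← map_smul,
      ← hc, rho_inv_apply]

variable [IsTopologicalGroup T]

/-- The representation on the same Hilbert space in which `t` acts as `t⁻¹` does on `X`.  If `X` is an
irreducible representation of an abelian group, so that `T` acts by unitary scalars, then this is, up
to isomorphism, the dual representation of `X`. -/
noncomputable def inverse (X : UnitaryRep T) : UnitaryRep T where
  V := X.V
  ρ :=
    { toFun := fun t => X.ρ t⁻¹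
      map_one' := by simp
      map_mul' := fun s t => by rw [← map_mul, mul_inv] }
  inner_map t v w := X.inner_map t⁻¹ v w
  continuous v := (X.continuous v).comp continuous_inv

theorem isIrreducible_inverse {X : UnitaryRep T} (hX : X.ρ.IsIrreducible) :
    X.inverse.ρ.IsIrreducible :=
  isIrreducible_of_finrank (X := X.inverse) (finrank_irreducible (X := X) hX)

/-- An isomorphism of representations gives one of their inverses. -/
noncomputable def inverseIso {X Y : UnitaryRep T} (e : X ≅ Y) : X.inverse ≅ Y.inverse where
  hom := ⟨e.hom.1, fun t v => e.hom.2 t⁻¹ v⟩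
  inv := ⟨e.inv.1, fun t v => e.inv.2 t⁻¹ v⟩
  hom_inv_id := Subtype.ext (congrArg Subtype.val e.hom_inv_id :)
  inv_hom_id := Subtype.ext (congrArg Subtype.val e.inv_hom_id :)

theorem inverse_tensor_iso {X : UnitaryRep T} (hX : X.ρ.IsIrreducible) :
    Nonempty (X.inverse ⊗ X ≅ 𝟙_ (UnitaryRep T)) := by
  have h1 : Module.finrank ℂ (X.V ⊗[ℂ] X.V) = Module.finrank ℂ ℂ := by
    rw [Module.finrank_tensorProduct, finrank_irreducible hX, Module.finrank_self]
  refine ⟨mkIso (X := X.inverse ⊗ X) (Y := 𝟙_ (UnitaryRep T)) (LinearEquiv.ofFinrankEq _ _ h1)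
    fun t v => ?_⟩
  exact congrArg (LinearEquiv.ofFinrankEq _ _ h1) (map_rho_inv_rho hX t v)

end Abelian

end UnitaryRep

/-- The group structure on the dual of an abelian group: `[ρ] [ρ'] = [ρ ⊗ ρ']`, and `[ρ]⁻¹` is the
class of the dual representation. -/
noncomputable instance (T : Type u) [CommGroup T] [TopologicalSpace T] [IsTopologicalGroup T] :
    CommGroup (DualGroup T) where
  mul := Quotient.map₂ (fun X Y => ⟨X.1 ⊗ Y.1, isIrreducible_tensor X.2 Y.2⟩)
    fun _ _ ⟨e⟩ _ _ ⟨e'⟩ => ⟨e ⊗ᵢ e'⟩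
  one := Quotient.mk _ ⟨𝟙_ (UnitaryRep T), isIrreducible_unit⟩
  inv := Quotient.map (fun X => ⟨X.1.inverse, isIrreducible_inverse X.2⟩)
    fun _ _ ⟨e⟩ => ⟨inverseIso e⟩
  mul_assoc := by
    rintro ⟨X⟩ ⟨Y⟩ ⟨Z⟩
    exact Quotient.sound ⟨α_ X.1 Y.1 Z.1⟩
  one_mul := by
    rintro ⟨X⟩
    exact Quotient.sound ⟨λ_ X.1⟩
  mul_one := by
    rintro ⟨X⟩
    exact Quotient.sound ⟨ρ_ X.1⟩
  inv_mul_cancel := by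
    rintro ⟨X⟩
    exact Quotient.sound (inverse_tensor_iso X.2)
  mul_comm := by
    rintro ⟨X⟩ ⟨Y⟩
    exact Quotient.sound ⟨β_ X.1 Y.1⟩

/-- The categorified Fourier transform `Rep(T) ⥤ Hilb[T̂]`: it sends a representation `x` to the family
of its isotypic components `x(g)`, `g ∈ T̂`, and an intertwiner to the linear map it is. -/
noncomputable def fourierTransform (T : Type u) [CommGroup T] [TopologicalSpace T] :
    UnitaryRep T ⥤ GradedHilb (DualGroup T) where
  obj X :=
    { V := X.V
      grade := X.isotypic
      orthogonal := X.isotypic_orthogonal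
      iSup_grade := X.iSup_isotypic }
  map f := ⟨f.1, isotypic_map f⟩

/-! ## H*-categories -/

namespace HStarCategory

section

variable {C : Type u} [Category.{v} C] [Preadditive C] [Linear ℂ C] [HStarCategory C]

/-! Irreducible representations of an abelian group are one-dimensional, so a class `g` in the dual
amounts to a continuous unitary character, and the isotypic component `x(g)` is the joint eigenspace
on which each `t` acts by the scalar `character g t` (`mem_isotypic_iff`). A representation is
therefore the same thing as an orthogonal grading by characters: the inverse functor lets `t` act on
a graded space by `character g t` in degree `g`. Both functors leave the underlying Hilbert spaces
and linear maps alone, so the unit, the counit and all structure maps are identities there, and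
every coherence condition is immediate.

What has to be proved is that these identities respect gradings and actions. Since `character (g *
h) t = character g t * character h t`, the homogeneous parts of a convolution product lie in the
isotypic components of the tensor product. The opposite inclusion is formal: an orthogonal family
that contains an orthogonal decomposition degree by degree coincides with it
(`le_grade_of_grade_le`).

The abelian structure rests on positivity of the inner product. If `a f f* = 0` then `a f = 0`; with
finite-dimensional hom-spaces this splits every monomorphism, and by taking adjoints every
epimorphism. Hence monos and epis are normal, cokernels are adjoints of kernels, and every additive
functor into a category with a zero object preserves short exact sequences. For `Rep(T)` this leaves
the zero object, direct sums, kernels and duals to be constructed; for the graded side they are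
transported along the inverse Fourier transform. -/

theorem dagger_id (X : C) : dagger (𝟙 X) = 𝟙 X := by
  have h := dagger_comp (dagger (𝟙 X)) (𝟙 X)
  rw [Category.comp_id, dagger_dagger, Category.comp_id] at h
  exact h.symm

theorem dagger_zero (X Y : C) : dagger (0 : X ⟶ Y) = 0 := by
  simpa using dagger_smul (0 : ℂ) (0 : X ⟶ Y)

theorem dagger_injective {X Y : C} : Function.Injective (dagger : (X ⟶ Y) → (Y ⟶ X)) :=
  Function.LeftInverse.injective dagger_dagger

/-- The positivity of the inner product makes `f ↦ f f*` definite. -/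
theorem comp_eq_zero_of_comp_comp_dagger_eq_zero {W X Y : C} (a : W ⟶ X) (f : X ⟶ Y)
    (h : a ≫ f ≫ dagger f = 0) : a ≫ f = 0 := by
  refine (homInner W Y).definite _ ?_
  -- `⟨a f, a f⟩ = ⟨a, a f f*⟩ = ⟨a, 0⟩`. That `⟨a, 0⟩ = 0` follows from conjugate-linearity with
  -- scalar `0` in the first variable and conjugate symmetry.
  rw [inner_comp_right, Category.assoc, h]
  have h0 := (homInner W X).smul_left (0 : W ⟶ X) a 0
  have h1 := (homInner W X).conj_inner_symm a 0
  rw [zero_smul, map_zero, zero_mul] at h0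
  rw [← h1, h0, map_zero]

/-- Every monomorphism of an H*-category splits. -/
theorem exists_retraction {X Y : C} (f : X ⟶ Y) [Mono f] : ∃ r : Y ⟶ X, f ≫ r = 𝟙 X := by
  have := finite X X
  -- The map `a ↦ a f f*` on the finite-dimensional space of endomorphisms of `X` is injective by
  -- definiteness and because `f` is mono. It is therefore surjective and hits `𝟙 X`.
  let φ : (X ⟶ X) →ₗ[ℂ] (X ⟶ X) := Linear.rightComp ℂ X (f ≫ dagger f)
  have hφ : Function.Injective φ := by
    rw [← LinearMap.ker_eq_bot, LinearMap.ker_eq_bot']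
    intro a ha
    exact zero_of_comp_mono f (comp_eq_zero_of_comp_comp_dagger_eq_zero a f ha)
  obtain ⟨a, ha⟩ := LinearMap.injective_iff_surjective.1 hφ (𝟙 X)
  replace ha : a ≫ f ≫ dagger f = 𝟙 X := ha
  -- The adjoint of `a f f* = 1` is `f f* a* = 1`, which exhibits `f* a*` as a retraction.
  refine ⟨dagger f ≫ dagger a, ?_⟩
  have h := congrArg dagger ha
  simpa only [dagger_comp, dagger_dagger, Category.assoc, dagger_id] using h

/-- Every epimorphism of an H*-category splits. -/
theorem exists_section {X Y : C} (f : X ⟶ Y) [Epi f] : ∃ s : Y ⟶ X, s ≫ f = 𝟙 Y := by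
  -- The adjoint turns the epi `f` into a mono, and a retraction of `f*` into a section of `f`.
  have : Mono (dagger f) := ⟨fun a b h => dagger_injective <| by
    have h' := congrArg dagger h
    rw [dagger_comp, dagger_comp, dagger_dagger] at h'
    exact (cancel_epi f).1 h'⟩
  obtain ⟨r, hr⟩ := exists_retraction (dagger f)
  refine ⟨dagger r, ?_⟩
  have h := congrArg dagger hr
  rwa [dagger_comp, dagger_dagger, dagger_id] at h

variable (C) in
-- If `r` is a retraction of `f`, then `f` is a kernel of the idempotent `1 - r f`: a morphism `k`
-- killed by it satisfies `k = (k r) f`.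
theorem isNormalMonoCategory : IsNormalMonoCategory C where
  normalMonoOfMono {X Y} f _ := by
    obtain ⟨r, hr⟩ := exists_retraction f
    have w : f ≫ (𝟙 Y - r ≫ f) = 0 := by
      rw [Preadditive.comp_sub, reassoc_of% hr, Category.comp_id, sub_self]
    exact ⟨⟨Y, 𝟙 Y - r ≫ f, w, KernelFork.IsLimit.ofι' f w fun {W} k hk => ⟨k ≫ r, by
      rw [Preadditive.comp_sub, Category.comp_id, sub_eq_zero] at hk
      rw [Category.assoc, ← hk]⟩⟩⟩

variable (C) in
-- Dually, an epi `f` with section `s` is a cokernel of `1 - f s`.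
theorem isNormalEpiCategory : IsNormalEpiCategory C where
  normalEpiOfEpi {X Y} f _ := by
    obtain ⟨s, hs⟩ := exists_section f
    have w : (𝟙 X - f ≫ s) ≫ f = 0 := by
      rw [Preadditive.sub_comp, Category.assoc, hs, Category.comp_id, Category.id_comp, sub_self]
    exact ⟨⟨X, 𝟙 X - f ≫ s, w, CokernelCofork.IsColimit.ofπ' f w fun {W} k hk => ⟨s ≫ k, by
      rw [Preadditive.sub_comp, Category.id_comp, sub_eq_zero] at hk
      rw [← Category.assoc, ← hk]⟩⟩⟩

variable (C) in
/-- The adjoint of a kernel of `f*` is a cokernel of `f`. -/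
theorem hasCokernels [HasKernels C] : HasCokernels C where
  has_colimit {X Y} f := by
    have w : f ≫ dagger (kernel.ι (dagger f)) = 0 := dagger_injective <| by
      rw [dagger_comp, dagger_dagger, kernel.condition, dagger_zero]
    refine ⟨⟨_, CokernelCofork.IsColimit.ofπ (dagger (kernel.ι (dagger f))) w
      (fun {W} k hk => dagger (kernel.lift (dagger f) (dagger k) ?_)) (fun {W} k hk => ?_)
      fun {W} k hk m hm => ?_⟩⟩
    · rw [← dagger_comp, hk, dagger_zero]
    · rw [← dagger_comp, kernel.lift_ι, dagger_dagger]
    · refine dagger_injective ((cancel_mono (kernel.ι (dagger f))).1 ?_)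
      rw [dagger_dagger, kernel.lift_ι, ← hm, dagger_comp, dagger_dagger]

variable (C) in
/-- An H*-category with a zero object, binary direct sums and kernels is abelian. -/
theorem isTwoHilbertSpace [h0 : HasZeroObject C] [h2 : HasBinaryBiproducts C]
    [hk : HasKernels C] : IsTwoHilbertSpace C :=
  ⟨h0, h2, hk, hasCokernels C, isNormalMonoCategory C, isNormalEpiCategory C⟩

end

end HStarCategory

open HStarCategory

/-! ### Automatic exactness and transport along equivalences -/

section

variable {C : Type*} [Category* C] [Preadditive C] [Linear ℂ C] [HStarCategory C]

/-- Short exact sequences in an H*-category split, so every additive functor is exact. -/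
theorem shortExact_map {D : Type*} [Category* D] [Preadditive D]
    [HasZeroObject D] (F : C ⥤ D) [F.Additive] {S : ShortComplex C}
    (hS : S.ShortExact) : (S.map F).ShortExact := by
  have := hS.mono_f
  -- Normality of monos makes `C` balanced, which is what turns exactness together with a retraction
  -- into a splitting.
  have := isNormalMonoCategory C
  obtain ⟨r, hr⟩ := exists_retraction S.f
  exact ((ShortComplex.Splitting.ofExactOfRetraction S hS.exact r hr hS.epi_g).map F).shortExact

variable {D : Type*} [Category* D] [Preadditive D] [Linear ℂ D] [HStarCategory D]

/-- Exactness costs nothing, since a split sequence stays split under an additive functor. -/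
theorem isTwoHilbertMorphism_of_map_dagger [HasZeroObject D] (F : C ⥤ D) [hF : F.Additive]
    [hL : F.Linear ℂ] (h : ∀ {X Y : C} (f : X ⟶ Y), F.map (dagger f) = dagger (F.map f)) :
    IsTwoHilbertMorphism F :=
  ⟨hF, hL, h, fun _ hS => shortExact_map F hS⟩

/-- An H*-category which is equivalent, as a category, to a 2-Hilbert space is a 2-Hilbert space. -/
theorem IsTwoHilbertSpace.of_equivalence (hC : IsTwoHilbertSpace C) (F : D ⥤ C)
    [F.IsEquivalence] : IsTwoHilbertSpace D := by
  obtain ⟨h0, h2, hk, -, -, -⟩ := hC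
  have : HasTerminal D := Adjunction.hasLimitsOfShape_of_equivalence F
  have : HasZeroObject D := hasZeroObject_of_hasTerminal_object
  have : HasBinaryProducts D := Adjunction.hasLimitsOfShape_of_equivalence F
  have : HasBinaryBiproducts D := HasBinaryBiproducts.of_hasBinaryProducts
  -- `F` is not assumed additive, and kernels refer to zero morphisms. Equalizers do not, so kernels
  -- are carried from `C` to `D` in that form.
  have : HasEqualizers C := Preadditive.hasEqualizers_of_hasKernels
  have : HasEqualizers D := Adjunction.hasLimitsOfShape_of_equivalence F
  exact isTwoHilbertSpace D

end

/-! ## `Rep(T)` is a symmetric 2-H*-algebra -/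

namespace UnitaryRep

section Abelian

variable {T : Type u} [Group T] [TopologicalSpace T]

instance : HasZeroObject (UnitaryRep T) where
  zero := ⟨(trivialRep T).sub ⊥ fun t v hv => by rw [(Submodule.mem_bot ℂ).1 hv]; simp, by
    rw [IsZero.iff_id_eq_zero]
    exact ext_linear fun v => Subsingleton.elim (α := (⊥ : Submodule ℂ ℂ)) _ _⟩

/-- The orthogonal direct sum of two representations. -/
noncomputable def directSum (X Y : UnitaryRep T) : UnitaryRep T where
  V := WithLp 2 (X.V × Y.V)
  ρ :=
    { toFun := fun t => (WithLp.linearEquiv 2 ℂ (X.V × Y.V)).symm.conj ((X.ρ t).prodMap (Y.ρ t))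
      map_one' := by ext : 1; simp
      map_mul' := fun s t => by ext : 1; simp }
  inner_map t v w := by
    simp [X.inner_map, Y.inner_map]
  continuous v := by
    exact (WithLp.prod_continuous_toLp 2 X.V Y.V).comp
      ((X.continuous v.fst).prodMk (Y.continuous v.snd))

instance : HasBinaryBiproducts (UnitaryRep T) where
  has_binary_biproduct X Y := hasBinaryBiproduct_of_total
    { pt := directSum X Y
      fst := ⟨LinearMap.fst ℂ X.V Y.V ∘ₗ (WithLp.linearEquiv 2 ℂ (X.V × Y.V)).toLinearMap,
        fun _ _ => rfl⟩
      snd := ⟨LinearMap.snd ℂ X.V Y.V ∘ₗ (WithLp.linearEquiv 2 ℂ (X.V × Y.V)).toLinearMap,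
        fun _ _ => rfl⟩
      inl := ⟨(WithLp.linearEquiv 2 ℂ (X.V × Y.V)).symm.toLinearMap ∘ₗ LinearMap.inl ℂ X.V Y.V,
        fun t _ => congrArg (WithLp.toLp 2) (Prod.ext rfl (map_zero (Y.ρ t)).symm)⟩
      inr := ⟨(WithLp.linearEquiv 2 ℂ (X.V × Y.V)).symm.toLinearMap ∘ₗ LinearMap.inr ℂ X.V Y.V,
        fun t _ => congrArg (WithLp.toLp 2) (Prod.ext (map_zero (X.ρ t)).symm rfl)⟩
      inl_fst := rfl
      inl_snd := rfl
      inr_fst := rfl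
      inr_snd := rfl }
    (ext_linear fun v => congrArg (WithLp.toLp 2)
      (Prod.ext (add_zero v.fst) (zero_add v.snd)))

theorem ker_invariant {X Y : UnitaryRep T} (f : X ⟶ Y) (t : T) :
    ∀ v ∈ LinearMap.ker f.1, X.ρ t v ∈ LinearMap.ker f.1 := fun v hv => by
  rw [LinearMap.mem_ker] at hv ⊢
  rw [f.2, hv, map_zero]

instance : HasKernels (UnitaryRep T) where
  has_limit {X Y} f := by
    let i : X.sub (LinearMap.ker f.1) (ker_invariant f) ⟶ X :=
      ⟨(LinearMap.ker f.1).subtype, fun _ _ => rfl⟩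
    have w : i ≫ f = 0 := ext_linear fun v => LinearMap.mem_ker.1 (Subtype.property v)
    exact ⟨⟨_, KernelFork.IsLimit.ofι i w
      (fun k hk => ⟨k.1.codRestrict _ fun v => LinearMap.congr_fun (congrArg Subtype.val hk) v,
        fun t v => Subtype.ext (k.2 t v)⟩)
      (fun k hk => rfl)
      fun k hk m hm => ext_linear fun v => Subtype.ext
        (LinearMap.congr_fun (congrArg Subtype.val hm) v)⟩⟩

variable (T) in
theorem isTwoHilbertSpace : IsTwoHilbertSpace (UnitaryRep T) :=
  HStarCategory.isTwoHilbertSpace (UnitaryRep T)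

end Abelian

/-! ### Unitarity of the structure maps and the tensor functors -/

section Monoidal

variable {T : Type u} [Group T] [TopologicalSpace T]

/-- For an isometric isomorphism `e`, `⟨e⁻¹ y, x⟩ = ⟨e e⁻¹ y, e x⟩ = ⟨y, e x⟩`, so the adjoint of
`e` is its inverse. Unitarity of the associator, unit laws and braiding thus reduces to their being
isometric. -/
theorem isUnitary_of_inner {X Y : UnitaryRep T} (e : X ≅ Y)
    (h : ∀ v w, inner ℂ (e.hom.1 v) (e.hom.1 w) = inner ℂ v w) : IsUnitary e.hom := by
  have hd : dagger e.hom = e.inv := by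
    refine Subtype.ext (((LinearMap.eq_adjoint_iff _ _).2 fun y x => ?_).symm)
    rw [← h]
    exact congrArg (inner ℂ · _) (LinearMap.congr_fun (congrArg Subtype.val e.inv_hom_id) y)
  exact ⟨by rw [hd, e.hom_inv_id], by rw [hd, e.inv_hom_id]⟩

theorem tensorLeft_isTwoHilbertMorphism (X : UnitaryRep T) :
    IsTwoHilbertMorphism (tensorLeft X) :=
  isTwoHilbertMorphism_of_map_dagger _
    (hF := ⟨fun {_ _} {f g} => Subtype.ext (TensorProduct.map_add_right LinearMap.id f.1 g.1)⟩)
    (hL := ⟨fun {_ _} f c => Subtype.ext (TensorProduct.map_smul_right c LinearMap.id f.1)⟩)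
    fun {Y Z} f => Subtype.ext <| by
      refine Eq.trans ?_ (TensorProduct.adjoint_map (LinearMap.id : X.V →ₗ[ℂ] X.V) f.1).symm
      rw [LinearMap.adjoint_id]
      rfl

theorem tensorRight_isTwoHilbertMorphism (X : UnitaryRep T) :
    IsTwoHilbertMorphism (tensorRight X) :=
  isTwoHilbertMorphism_of_map_dagger _
    (hF := ⟨fun {_ _} {f g} => Subtype.ext (TensorProduct.map_add_left f.1 g.1 LinearMap.id)⟩)
    (hL := ⟨fun {_ _} f c => Subtype.ext (TensorProduct.map_smul_left c f.1 LinearMap.id)⟩)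
    fun {Y Z} f => Subtype.ext <| by
      refine Eq.trans ?_ (TensorProduct.adjoint_map f.1 (LinearMap.id : X.V →ₗ[ℂ] X.V)).symm
      rw [LinearMap.adjoint_id]
      rfl

end Monoidal

/-! ### Dual representations -/

section Dual

variable {T : Type u} [Group T] [TopologicalSpace T]

/-- The Hilbert space structure `⟪f, g⟫ = tr (f* g)` on the dual of a Hilbert space. -/
@[reducible]
noncomputable def dualCore (V : Type) [NormedAddCommGroup V] [InnerProductSpace ℂ V]
    [FiniteDimensional ℂ V] : InnerProductSpace.Core ℂ (Module.Dual ℂ V) where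
  inner f g := LinearMap.trace ℂ V (LinearMap.adjoint f ∘ₗ g)
  conj_inner_symm f g := hilbSchmidt_conj f g
  re_inner_nonneg f := (hilbSchmidtCore (⊤ : Submodule ℂ (V →ₗ[ℂ] ℂ))).re_inner_nonneg ⟨f, trivial⟩
  add_left f g h := by simp [LinearMap.add_comp]
  smul_left f g c := by simp [map_smulₛₗ, LinearMap.smul_comp]
  definite f hf := congrArg Subtype.val
    ((hilbSchmidtCore (⊤ : Submodule ℂ (V →ₗ[ℂ] ℂ))).definite ⟨f, trivial⟩ hf)

theorem adjoint_rho (X : UnitaryRep T) (t : T) : LinearMap.adjoint (X.ρ t) = X.ρ t⁻¹ := by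
  refine ((LinearMap.eq_adjoint_iff _ _).2 fun v w => ?_).symm
  rw [inner_rho_left, inv_inv]

theorem rho_comp_rho_inv (X : UnitaryRep T) (t : T) : X.ρ t ∘ₗ X.ρ t⁻¹ = LinearMap.id :=
  LinearMap.ext (X.rho_apply_inv t)

theorem contractLeft_equivariant (X : UnitaryRep T) (t : T) (v : Module.Dual ℂ X.V ⊗[ℂ] X.V) :
    contractLeft ℂ X.V (TensorProduct.map (X.ρ.dual t) (X.ρ t) v) = contractLeft ℂ X.V v := by
  induction v with
  | zero => simp
  | add v w hv hw => rw [map_add, map_add, map_add, hv, hw]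
  | tmul f v => simp [Representation.dual_apply, Module.Dual.transpose_apply]

/-- The coevaluation at `1` is the tensor corresponding to the identity operator, which is fixed by
conjugation with `ρ t`. The proof carries this out in a basis. -/
theorem coevaluation_equivariant (X : UnitaryRep T) (t : T) :
    TensorProduct.map (X.ρ t) (X.ρ.dual t) (coevaluation ℂ X.V 1) = coevaluation ℂ X.V 1 := by
  let b := Module.Basis.ofVectorSpace ℂ X.V
  rw [coevaluation_apply_one, map_sum]
  classical
  -- The dual action on the dual basis is given by the matrix of `ρ t⁻¹`. Once its coefficients are
  -- moved to the other tensor factor, `h2` sums them to `ρ t (ρ t⁻¹ (b j)) = b j`.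
  have h1 : ∀ i, X.ρ.dual t (b.coord i) = ∑ j, b.coord i (X.ρ t⁻¹ (b j)) • b.coord j := by
    intro i
    refine b.ext fun k => ?_
    simp [Representation.dual_apply, Module.Dual.transpose_apply, Finsupp.single_apply]
  have h2 : ∀ j, ∑ i, b.coord i (X.ρ t⁻¹ (b j)) • X.ρ t (b i) = b j := by
    intro j
    simp_rw [← map_smul, ← map_sum]
    simp only [Module.Basis.coord_apply, b.sum_repr, rho_apply_inv]
  calc ∑ i, TensorProduct.map (X.ρ t) (X.ρ.dual t) (b i ⊗ₜ[ℂ] b.coord i)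
      = ∑ i, ∑ j, (b.coord i (X.ρ t⁻¹ (b j)) • X.ρ t (b i)) ⊗ₜ[ℂ] b.coord j := by
        refine Finset.sum_congr rfl fun i _ => ?_
        rw [TensorProduct.map_tmul, h1, TensorProduct.tmul_sum]
        simp only [TensorProduct.tmul_smul, TensorProduct.smul_tmul']
    _ = ∑ j, b j ⊗ₜ[ℂ] b.coord j := by
        rw [Finset.sum_comm]
        simp only [← TensorProduct.sum_tmul, h2]

variable [IsTopologicalGroup T]

/-- The dual representation. -/
noncomputable def dual (X : UnitaryRep T) : UnitaryRep T :=
  letI n : NormedAddCommGroup (Module.Dual ℂ X.V) :=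
    @InnerProductSpace.Core.toNormedAddCommGroup ℂ _ _ _ _ (dualCore X.V)
  letI i : InnerProductSpace ℂ (Module.Dual ℂ X.V) := InnerProductSpace.ofCore _
  { V := Module.Dual ℂ X.V
    normed := n
    innerProduct := i
    finiteDimensional := inferInstanceAs (FiniteDimensional ℂ (Module.Dual ℂ X.V))
    ρ := X.ρ.dual
    inner_map := fun t f g => by
      change LinearMap.trace ℂ X.V (LinearMap.adjoint (f ∘ₗ X.ρ t⁻¹) ∘ₗ (g ∘ₗ X.ρ t⁻¹)) =
        LinearMap.trace ℂ X.V (LinearMap.adjoint f ∘ₗ g)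
      -- Cyclicity of the trace brings `ρ t⁻¹` next to its adjoint, which is its inverse.
      rw [hilbSchmidt_comp_left, adjoint_rho, LinearMap.comp_assoc, rho_comp_rho_inv,
        LinearMap.comp_id]
    continuous := fun f => by
      let b := Module.finBasis ℂ X.V
      let e := b.dualBasis.equivFun.toContinuousLinearEquiv
      refine e.toHomeomorph.comp_continuous_iff.1 (continuous_pi fun i => ?_)
      -- Coordinates in the dual basis are values on the basis vectors, so continuity reduces to
      -- that of the orbit maps of `X` and of inversion in `T`.
      have h : ∀ t, e (X.ρ.dual t f) i = f (X.ρ t⁻¹ (b i)) := fun t => by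
        change b.dualBasis.equivFun (X.ρ.dual t f) i = _
        rw [Module.Basis.equivFun_apply, Module.Basis.dualBasis_repr]
        rfl
      exact (f.continuous_of_finiteDimensional.comp
        ((X.continuous (b i)).comp continuous_inv)).congr fun t => (h t).symm }

/-- The evaluation and coevaluation of vector spaces make the dual representation a dual object. -/
@[reducible]
noncomputable def exactPairingDual (X : UnitaryRep T) : ExactPairing X X.dual where
  coevaluation' := ⟨coevaluation ℂ X.V, fun t (c : ℂ) => by
    have h : c = c • (1 : ℂ) := by simp
    change coevaluation ℂ X.V c =
      TensorProduct.map (X.ρ t) (X.ρ.dual t) (coevaluation ℂ X.V c)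
    rw [h, map_smul, map_smul, coevaluation_equivariant]⟩
  evaluation' := ⟨contractLeft ℂ X.V, contractLeft_equivariant X⟩
  coevaluation_evaluation' := Subtype.ext (contractLeft_assoc_coevaluation ℂ X.V)
  evaluation_coevaluation' := Subtype.ext (contractLeft_assoc_coevaluation' ℂ X.V)

variable (T) in
theorem isSymmetricTwoHStarAlgebra : IsSymmetricTwoHStarAlgebra (UnitaryRep T) where
  toIsTwoHilbertSpace := isTwoHilbertSpace T
  tensorLeft_morphism := tensorLeft_isTwoHilbertMorphism
  tensorRight_morphism := tensorRight_isTwoHilbertMorphism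
  unitary_associator X Y Z := isUnitary_of_inner (α_ X Y Z) TensorProduct.inner_assoc_assoc
  unitary_leftUnitor X := isUnitary_of_inner (λ_ X) TensorProduct.inner_lid_lid
  unitary_rightUnitor X := isUnitary_of_inner (ρ_ X) TensorProduct.inner_rid_rid
  unitary_braiding X Y := isUnitary_of_inner (β_ X Y) TensorProduct.inner_comm_comm
  exists_dual X := ⟨X.dual, ⟨exactPairingDual X⟩⟩

end Dual

end UnitaryRep

/-! ## Graded Hilbert spaces -/

namespace GradedHilb

/-! ### Comparison of gradings, and operators that are scalar in each degree -/

section Diagonal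

variable {G : Type u}

/-- A vector of `S g` is orthogonal to every `S h` with `h ≠ g`, hence to every other homogeneous
part of `X`, and so lies in degree `g`. This supplies the reverse inclusion whenever gradings are
compared with isotypic components. -/
theorem le_grade_of_grade_le (X : GradedHilb G) {S : G → Submodule ℂ X.V}
    (hS : ∀ g h, g ≠ h → S g ⟂ S h) (hle : ∀ g, X.grade g ≤ S g) (g : G) : S g ≤ X.grade g :=
  fun w hw => X.mem_grade_of_inner_eq_zero g w fun h hg v hv =>
    Submodule.isOrtho_iff_inner_eq.1 (hS h g hg) v (hle h hv) w hw

@[elab_as_elim]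
theorem induction_on {X : GradedHilb G} {p : X.V → Prop} (v : X.V) (zero : p 0)
    (mem : ∀ g, ∀ v ∈ X.grade g, p v) (add : ∀ v w, p v → p w → p (v + w)) : p v :=
  Submodule.iSup_induction X.grade (motive := p) (X.iSup_grade.ge (trivial : v ∈ ⊤)) mem zero add

theorem isInternal [DecidableEq G] (X : GradedHilb G) : DirectSum.IsInternal X.grade := by
  have h : OrthogonalFamily ℂ (fun g => X.grade g) fun g => (X.grade g).subtypeₗᵢ :=
    OrthogonalFamily.of_pairwise fun g h hgh => X.orthogonal g h hgh
  rw [h.isInternal_iff, X.iSup_grade, Submodule.top_orthogonal_eq_bot]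

open Classical in
/-- The linear operator which is multiplication by `c g` in degree `g`. -/
noncomputable def diagonal (X : GradedHilb G) (c : G → ℂ) : X.V →ₗ[ℂ] X.V :=
  DirectSum.toModule ℂ G X.V (fun g => c g • (X.grade g).subtype) ∘ₗ
    (LinearEquiv.ofBijective (DirectSum.coeLinearMap X.grade) X.isInternal).symm.toLinearMap

theorem diagonal_apply (X : GradedHilb G) (c : G → ℂ) {g : G} {v : X.V} (hv : v ∈ X.grade g) :
    X.diagonal c v = c g • v := by
  classical
  have h : (LinearEquiv.ofBijective (DirectSum.coeLinearMap X.grade) X.isInternal).symm v =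
      DirectSum.lof ℂ G (fun g => X.grade g) g ⟨v, hv⟩ := by
    rw [LinearEquiv.symm_apply_eq]
    exact (DirectSum.coeLinearMap_lof X.grade g ⟨v, hv⟩).symm
  rw [diagonal, LinearMap.comp_apply]
  erw [h]
  rw [DirectSum.toModule_lof]
  rfl

theorem diagonal_comm {X Y : GradedHilb G} (f : X ⟶ Y) (c : G → ℂ) (v : X.V) :
    f.1 (X.diagonal c v) = Y.diagonal c (f.1 v) := by
  induction v using induction_on with
  | zero => simp only [map_zero]
  | mem g v hv => rw [X.diagonal_apply c hv, Y.diagonal_apply c (f.2 g v hv), map_smul]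
  | add v w hv hw => simp only [map_add, hv, hw]

theorem diagonal_one (X : GradedHilb G) : X.diagonal 1 = LinearMap.id := by
  ext v
  induction v using induction_on with
  | zero => simp only [map_zero]
  | mem g v hv => rw [X.diagonal_apply 1 hv, Pi.one_apply, one_smul, LinearMap.id_apply]
  | add v w hv hw => simp only [map_add, hv, hw]

theorem diagonal_mul (X : GradedHilb G) (c d : G → ℂ) :
    X.diagonal (c * d) = X.diagonal c ∘ₗ X.diagonal d := by
  ext v
  induction v using induction_on with
  | zero => simp only [map_zero]
  | mem g v hv =>
    rw [LinearMap.comp_apply, X.diagonal_apply d hv, map_smul, X.diagonal_apply c hv,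
      X.diagonal_apply _ hv, smul_smul, mul_comm, Pi.mul_apply, mul_comm]
  | add v w hv hw => simp only [map_add, hv, hw]

/-- Different degrees are orthogonal, and within one degree the scalars contribute `|c g|² = 1`.
Applied to characters, this makes the inverse transform unitary. -/
theorem inner_diagonal (X : GradedHilb G) {c : G → ℂ} (hc : ∀ g, ‖c g‖ = 1) (v w : X.V) :
    inner ℂ (X.diagonal c v) (X.diagonal c w) = inner ℂ v w := by
  induction v using induction_on with
  | zero => simp only [map_zero, inner_zero_left]
  | add v v' h h' => simp only [map_add, inner_add_left, h, h']
  | mem g v hv =>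
    induction w using induction_on with
    | zero => simp only [map_zero, inner_zero_right]
    | add w w' h h' => simp only [map_add, inner_add_right, h, h']
    | mem h w hw =>
      rw [X.diagonal_apply c hv, X.diagonal_apply c hw, inner_smul_left, inner_smul_right]
      by_cases hgh : g = h
      · rw [hgh, ← mul_assoc, RCLike.conj_mul, hc]
        simp
      · rw [Submodule.isOrtho_iff_inner_eq.1 (X.orthogonal g h hgh) v hv w hw, mul_zero, mul_zero]

theorem continuous_diagonal (X : GradedHilb G) {S : Type*} [TopologicalSpace S] {c : S → G → ℂ}
    (hc : ∀ g, Continuous fun s => c s g) (v : X.V) : Continuous fun s => X.diagonal (c s) v := by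
  induction v using induction_on with
  | zero => simpa only [map_zero] using continuous_const
  | mem g v hv =>
    simp only [X.diagonal_apply _ hv]
    exact (hc g).smul continuous_const
  | add v w hv hw =>
    simp only [map_add]
    exact hv.add hw

theorem isUnitary_of_inner {X Y : GradedHilb G} (e : X ≅ Y)
    (h : ∀ v w, inner ℂ (e.hom.1 v) (e.hom.1 w) = inner ℂ v w) : IsUnitary e.hom := by
  have hd : dagger e.hom = e.inv := by
    refine Subtype.ext (((LinearMap.eq_adjoint_iff _ _).2 fun y x => ?_).symm)
    rw [← h]
    exact congrArg (inner ℂ · _) (LinearMap.congr_fun (congrArg Subtype.val e.inv_hom_id) y)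
  exact ⟨by rw [hd, e.hom_inv_id], by rw [hd, e.inv_hom_id]⟩

end Diagonal

section Monoidal

variable {G : Type u} [Group G]

theorem tensorLeft_isTwoHilbertMorphism [HasZeroObject (GradedHilb G)] (X : GradedHilb G) :
    IsTwoHilbertMorphism (tensorLeft X) :=
  isTwoHilbertMorphism_of_map_dagger _
    (hF := ⟨fun {_ _} {f g} => Subtype.ext (TensorProduct.map_add_right LinearMap.id f.1 g.1)⟩)
    (hL := ⟨fun {_ _} f c => Subtype.ext (TensorProduct.map_smul_right c LinearMap.id f.1)⟩)
    fun {Y Z} f => Subtype.ext <| by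
      refine Eq.trans ?_ (TensorProduct.adjoint_map (LinearMap.id : X.V →ₗ[ℂ] X.V) f.1).symm
      rw [LinearMap.adjoint_id]
      rfl

theorem tensorRight_isTwoHilbertMorphism [HasZeroObject (GradedHilb G)] (X : GradedHilb G) :
    IsTwoHilbertMorphism (tensorRight X) :=
  isTwoHilbertMorphism_of_map_dagger _
    (hF := ⟨fun {_ _} {f g} => Subtype.ext (TensorProduct.map_add_left f.1 g.1 LinearMap.id)⟩)
    (hL := ⟨fun {_ _} f c => Subtype.ext (TensorProduct.map_smul_left c f.1 LinearMap.id)⟩)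
    fun {Y Z} f => Subtype.ext <| by
      refine Eq.trans ?_ (TensorProduct.adjoint_map f.1 (LinearMap.id : X.V →ₗ[ℂ] X.V)).symm
      rw [LinearMap.adjoint_id]
      rfl

end Monoidal

section Symmetric

variable {G : Type u} [CommGroup G]

variable (G) in
-- The abelian structure and the duals enter as hypotheses because they are obtained for `G = T̂`
-- only, from `Rep(T)`.
theorem isSymmetricTwoHStarAlgebra (h : IsTwoHilbertSpace (GradedHilb G))
    (hd : ∀ X : GradedHilb G, ∃ Y : GradedHilb G, Nonempty (ExactPairing X Y)) :
    IsSymmetricTwoHStarAlgebra (GradedHilb G) :=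
  have := h.hasZeroObject
  { toIsTwoHilbertSpace := h
    tensorLeft_morphism := tensorLeft_isTwoHilbertMorphism
    tensorRight_morphism := tensorRight_isTwoHilbertMorphism
    unitary_associator := fun X Y Z => isUnitary_of_inner (α_ X Y Z) TensorProduct.inner_assoc_assoc
    unitary_leftUnitor := fun X => isUnitary_of_inner (λ_ X) TensorProduct.inner_lid_lid
    unitary_rightUnitor := fun X => isUnitary_of_inner (ρ_ X) TensorProduct.inner_rid_rid
    unitary_braiding := fun X Y => isUnitary_of_inner (β_ X Y) TensorProduct.inner_comm_comm
    exists_dual := hd }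

end Symmetric

end GradedHilb

/-! ## Characters -/

namespace UnitaryRep

section Character

variable {T : Type u} [CommGroup T] [TopologicalSpace T]

/-- The scalar by which `t` acts on the irreducible representations in the class `g`. -/
noncomputable def character (g : DualGroup T) (t : T) : ℂ :=
  (exists_scalar (Quotient.out g).2 t).choose

/-- An isomorphism with the representative chosen in `character` carries its scalars over, so the
character depends only on the class. -/
theorem rho_eq_character_smul {X : UnitaryRep T} (hX : X.ρ.IsIrreducible) (t : T) (v : X.V) :
    X.ρ t v = character (Quotient.mk _ ⟨X, hX⟩) t • v := by
  obtain ⟨e⟩ : Nonempty ((Quotient.mk _ ⟨X, hX⟩ : DualGroup T).out.1 ≅ X) :=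
    Quotient.exact (s := irrepSetoid T) (Quotient.out_eq _)
  have h := (exists_scalar (Quotient.out (Quotient.mk _ ⟨X, hX⟩ : DualGroup T)).2 t).choose_spec
    (e.inv.1 v)
  have hv : e.hom.1 (e.inv.1 v) = v :=
    LinearMap.congr_fun (congrArg Subtype.val e.inv_hom_id) v
  have h' := congrArg e.hom.1 h
  rwa [e.hom.2, hv, map_smul, hv] at h'

/-- The nonzero vector serves to cancel: identities between characters are read off from the action
on it. -/
theorem exists_rep (g : DualGroup T) : ∃ (X : Irrep T) (v : X.1.V), Quotient.mk _ X = g ∧ v ≠ 0 ∧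
    ∀ t w, X.1.ρ t w = character g t • w := by
  obtain ⟨⟨X, hX⟩, rfl⟩ := Quotient.exists_rep g
  have := ((isIrreducible_iff X).1 hX).1
  obtain ⟨v, hv⟩ := exists_ne (0 : X.V)
  exact ⟨⟨X, hX⟩, v, rfl, hv, rho_eq_character_smul hX⟩

/-- This is the bridge between gradings and actions. Intertwiners carry the scalar action on
irreducibles of class `g` into `X`; conversely, an eigenvector for the character is in the image of
an intertwiner from such an irreducible. -/
theorem mem_isotypic_iff {X : UnitaryRep T} {g : DualGroup T} {v : X.V} :
    v ∈ X.isotypic g ↔ ∀ t, X.ρ t v = character g t • v := by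
  constructor
  · intro hv t
    refine isotypic_le (S := LinearMap.eqLocus (X.ρ t) (character g t • LinearMap.id)) ?_ hv
    rintro ⟨Y, hY⟩ rfl f w
    change X.ρ t (f.1 w) = character _ t • f.1 w
    rw [← f.2, rho_eq_character_smul hY, map_smul]
  · intro hv
    obtain ⟨Y, y, hY, hy, hρ⟩ := exists_rep g
    obtain ⟨l, hl⟩ := Module.Projective.exists_dual_ne_zero ℂ hy
    -- The rank-one map `w ↦ l(w) v` intertwines because `T` acts by the same scalars on `Y` and on
    -- `v`. It takes `y` to `l(y) v`, where `l(y) ≠ 0`.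
    let f : Y.1 ⟶ X := ⟨l.smulRight v, fun t w => by
      rw [LinearMap.smulRight_apply, LinearMap.smulRight_apply, map_smul, hv, hρ, map_smul,
        smul_assoc, smul_comm]⟩
    have h : l y • v ∈ X.isotypic g := mem_isotypic Y hY f y
    exact (Submodule.smul_mem_iff _ hl).1 h

theorem character_one (g : DualGroup T) : character g (1 : T) = 1 := by
  obtain ⟨X, v, -, hv, h⟩ := exists_rep g
  have h1 := h 1 v
  rw [map_one, Module.End.one_apply] at h1
  exact (smul_left_injective ℂ hv (by simpa using h1)).symm

theorem character_mul (g : DualGroup T) (s t : T) :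
    character g (s * t) = character g s * character g t := by
  obtain ⟨X, v, -, hv, h⟩ := exists_rep g
  have h1 := h (s * t) v
  rw [map_mul, Module.End.mul_apply, h t, map_smul, h s, smul_smul, mul_comm] at h1
  exact (smul_left_injective ℂ hv h1).symm

theorem norm_character (g : DualGroup T) (t : T) : ‖character g t‖ = 1 := by
  obtain ⟨X, v, -, hv, h⟩ := exists_rep g
  have h1 := X.1.inner_map t v v
  rw [inner_self_eq_norm_sq_to_K, inner_self_eq_norm_sq_to_K, h, norm_smul] at h1
  norm_cast at h1
  rw [mul_pow] at h1
  have h2 := mul_right_cancel₀ (b := ‖v‖ ^ 2) (by positivity) (h1.trans (one_mul _).symm)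
  exact (pow_eq_one_iff_of_nonneg (norm_nonneg _) two_ne_zero).1 h2

theorem continuous_character (g : DualGroup T) : Continuous (character g) := by
  obtain ⟨X, v, -, hv, h⟩ := exists_rep g
  -- The character is a normalized matrix coefficient, `⟨v, ρ(t) v⟩ / ⟨v, v⟩`.
  have h1 : Continuous fun t => (inner ℂ v (X.1.ρ t v) / inner ℂ v v : ℂ) :=
    (continuous_const.inner (X.1.continuous v)).div_const _
  refine h1.congr fun t => ?_
  rw [h, inner_smul_right, mul_div_cancel_right₀ _ (inner_self_ne_zero.2 hv)]

variable [IsTopologicalGroup T]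

/-- The class `g * h` is represented by the tensor product of representatives, on which `t` acts by
the product of the two scalars. -/
theorem character_mul_left (g h : DualGroup T) (t : T) :
    character (g * h) t = character g t * character h t := by
  obtain ⟨⟨X, hX⟩, v, rfl, hv, hg⟩ := exists_rep g
  obtain ⟨⟨Y, hY⟩, w, rfl, hw, hh⟩ := exists_rep h
  have h1 : X.ρ t v ⊗ₜ[ℂ] Y.ρ t w = _ • (v ⊗ₜ[ℂ] w) :=
    rho_eq_character_smul (isIrreducible_tensor hX hY) t (v ⊗ₜ[ℂ] w)
  rw [hg, hh, TensorProduct.smul_tmul_smul] at h1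
  have h2 : v ⊗ₜ[ℂ] w ≠ 0 := by
    rw [← norm_ne_zero_iff, TensorProduct.norm_tmul]
    exact mul_ne_zero (norm_ne_zero_iff.2 hv) (norm_ne_zero_iff.2 hw)
  exact (smul_left_injective ℂ h2 h1).symm

theorem character_one_left (t : T) : character (1 : DualGroup T) t = 1 := by
  have h : (1 : ℂ) = character (1 : DualGroup T) t • (1 : ℂ) :=
    rho_eq_character_smul (X := 𝟙_ (UnitaryRep T)) isIrreducible_unit t (1 : ℂ)
  simpa using h.symm

end Character

end UnitaryRep

open UnitaryRep

/-! ### The inverse Fourier transform and the equivalence of categories -/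

section Fourier

variable (T : Type u) [CommGroup T] [TopologicalSpace T]

/-- The representation on a `T̂`-graded Hilbert space in which `T` acts by the character `g` in
degree `g`. -/
noncomputable def GradedHilb.toRep (X : GradedHilb (DualGroup T)) : UnitaryRep T where
  V := X.V
  ρ :=
    { toFun := fun t => X.diagonal fun g => character g t
      map_one' := by simp only [character_one]; exact X.diagonal_one
      map_mul' := fun s t => by
        simp only [character_mul]
        exact X.diagonal_mul _ _ }
  inner_map t := X.inner_diagonal fun g => norm_character g t
  continuous := X.continuous_diagonal continuous_character

/-- The inverse Fourier transform. -/
noncomputable def inverseFourierTransform : GradedHilb (DualGroup T) ⥤ UnitaryRep T where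
  obj X := X.toRep
  map f := ⟨f.1, fun _ => GradedHilb.diagonal_comm f _⟩

theorem grade_le_isotypic (X : GradedHilb (DualGroup T)) (g : DualGroup T) :
    X.grade g ≤ ((inverseFourierTransform T).obj X).isotypic g := fun _ hv =>
  mem_isotypic_iff.2 fun _ => X.diagonal_apply _ hv

theorem isotypic_le_grade (X : GradedHilb (DualGroup T)) (g : DualGroup T) :
    ((inverseFourierTransform T).obj X).isotypic g ≤ X.grade g :=
  X.le_grade_of_grade_le ((inverseFourierTransform T).obj X).isotypic_orthogonal
    (grade_le_isotypic T X) g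

/-- The action rebuilt from the isotypic components is the original one, since both agree on each
component and these span. -/
theorem diagonal_character_fourierTransform (X : UnitaryRep T) (t : T) (v : X.V) :
    ((fourierTransform T).obj X).diagonal (fun g => character g t) v = X.ρ t v := by
  induction v using GradedHilb.induction_on (X := (fourierTransform T).obj X) with
  | zero => exact (map_zero _).trans (map_zero (X.ρ t)).symm
  | mem g v hv => exact (GradedHilb.diagonal_apply _ _ hv).trans (mem_isotypic_iff.1 hv t).symm
  | add v w hv hw =>
    exact (map_add _ v w).trans ((congrArg₂ _ hv hw).trans ((X.ρ t).map_add v w).symm)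

/-- A representation is the direct sum of its isotypic components. -/
noncomputable def fourierUnitIso :
    𝟭 (UnitaryRep T) ≅ fourierTransform T ⋙ inverseFourierTransform T :=
  NatIso.ofComponents (fun X => UnitaryRep.mkIso (X := X)
    (Y := (fourierTransform T ⋙ inverseFourierTransform T).obj X) (LinearEquiv.refl ℂ X.V)
    fun t v => (diagonal_character_fourierTransform T X t v).symm) fun _ => rfl

/-- The isotypic components of a graded Hilbert space are its homogeneous parts. -/
noncomputable def fourierCounitIso :
    inverseFourierTransform T ⋙ fourierTransform T ≅ 𝟭 (GradedHilb (DualGroup T)) :=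
  NatIso.ofComponents (fun X => GradedHilb.mkIso
    (X := (inverseFourierTransform T ⋙ fourierTransform T).obj X) (Y := X)
    (LinearEquiv.refl ℂ X.V) (isotypic_le_grade T X) (grade_le_isotypic T X)) fun _ => rfl

instance : (inverseFourierTransform T).IsEquivalence :=
  (CategoryTheory.Equivalence.mk _ _ (fourierUnitIso T) (fourierCounitIso T)).isEquivalence_inverse

theorem gradedHilb_isTwoHilbertSpace : IsTwoHilbertSpace (GradedHilb (DualGroup T)) :=
  (UnitaryRep.isTwoHilbertSpace T).of_equivalence (inverseFourierTransform T)

theorem fourierTransform_isTwoHilbertMorphism : IsTwoHilbertMorphism (fourierTransform T) :=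
  have := (gradedHilb_isTwoHilbertSpace T).hasZeroObject
  isTwoHilbertMorphism_of_map_dagger _ (hF := ⟨rfl⟩) (hL := ⟨fun _ _ => rfl⟩) fun _ => rfl

theorem inverseFourierTransform_isTwoHilbertMorphism :
    IsTwoHilbertMorphism (inverseFourierTransform T) :=
  isTwoHilbertMorphism_of_map_dagger _ (hF := ⟨rfl⟩) (hL := ⟨fun _ _ => rfl⟩) fun _ => rfl

/-! ### Monoidal structure of the two transforms, and duals of graded spaces -/

variable [IsTopologicalGroup T]

/-- On `x(a) ⊗ y(b)` the group acts by the product of the characters `a` and `b`, which is the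
character `a * b`. Equality then follows from orthogonality of the isotypic components. -/
theorem tensorGrade_le_isotypic {X Y : UnitaryRep T} (g : DualGroup T) :
    GradedHilb.tensorGrade ((fourierTransform T).obj X) ((fourierTransform T).obj Y) g ≤
      (X ⊗ Y).isotypic g :=
  GradedHilb.tensorGrade_le fun a b hab (v : X.V) hv (w : Y.V) hw => mem_isotypic_iff.2 fun t => by
    change X.ρ t v ⊗ₜ[ℂ] Y.ρ t w = _ • (v ⊗ₜ[ℂ] w)
    rw [mem_isotypic_iff.1 hv, mem_isotypic_iff.1 hw, TensorProduct.smul_tmul_smul, ← hab,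
      character_mul_left]
    rfl

theorem unitObj_grade_le_isotypic (g : DualGroup T) :
    (GradedHilb.unitObj (DualGroup T)).grade g ≤ (𝟙_ (UnitaryRep T)).isotypic g := by
  refine iSup_le fun hg (v : ℂ) _ => mem_isotypic_iff.2 fun t => ?_
  rw [hg, character_one_left]
  exact (one_smul ℂ v).symm

/-- The categorified Fourier transform with the structure maps that are the identity on the
underlying Hilbert spaces. -/
noncomputable def fourierCoreMonoidal : (fourierTransform T).CoreMonoidal where
  εIso := GradedHilb.mkIso (X := GradedHilb.unitObj (DualGroup T))
    (Y := (fourierTransform T).obj (𝟙_ (UnitaryRep T))) (LinearEquiv.refl ℂ ℂ)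
    (unitObj_grade_le_isotypic T)
    ((GradedHilb.unitObj (DualGroup T)).le_grade_of_grade_le
      (𝟙_ (UnitaryRep T)).isotypic_orthogonal (unitObj_grade_le_isotypic T))
  μIso X Y := GradedHilb.mkIso
    (X := GradedHilb.tensor ((fourierTransform T).obj X) ((fourierTransform T).obj Y))
    (Y := (fourierTransform T).obj (X ⊗ Y)) (LinearEquiv.refl ℂ (X.V ⊗[ℂ] Y.V))
    (tensorGrade_le_isotypic T)
    ((GradedHilb.tensor ((fourierTransform T).obj X)
      ((fourierTransform T).obj Y)).le_grade_of_grade_le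
      (X ⊗ Y).isotypic_orthogonal (tensorGrade_le_isotypic T))
  μIso_hom_natural_left _ _ := GradedHilb.hom_ext_two fun _ _ => rfl
  μIso_hom_natural_right _ _ := GradedHilb.hom_ext_two fun _ _ => rfl
  associativity _ _ _ := GradedHilb.hom_ext_three fun _ _ _ => rfl
  left_unitality _ := GradedHilb.hom_ext_two fun _ _ => rfl
  right_unitality _ := GradedHilb.hom_ext_two fun _ _ => rfl

noncomputable instance fourierBraided : (fourierTransform T).Braided where
  toMonoidal := (fourierCoreMonoidal T).toMonoidal
  braided _ _ := GradedHilb.hom_ext_two fun _ _ => rfl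

/-- Multiplicativity of characters again, now making the identity an intertwiner for the structure
map of the inverse transform. -/
theorem tensor_diagonal_character (X Y : GradedHilb (DualGroup T)) (t : T) (v : X.V ⊗[ℂ] Y.V) :
    TensorProduct.map (X.diagonal fun g => character g t) (Y.diagonal fun g => character g t) v =
      (X ⊗ Y).diagonal (fun g => character g t) v := by
  induction v using GradedHilb.induction_on (X := X ⊗ Y) with
  | zero => exact (map_zero _).trans (map_zero _).symm
  | mem g v hv =>
    refine Eq.trans ?_ (GradedHilb.diagonal_apply _ _ hv).symm
    revert v
    refine GradedHilb.tensorGrade_le (S := LinearMap.eqLocus (TensorProduct.map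
      (X.diagonal fun g => character g t) (Y.diagonal fun g => character g t))
        (character g t • LinearMap.id)) fun a b hab v hv w hw => ?_
    change X.diagonal _ v ⊗ₜ[ℂ] Y.diagonal _ w = character g t • (v ⊗ₜ[ℂ] w)
    rw [X.diagonal_apply _ hv, Y.diagonal_apply _ hw, TensorProduct.smul_tmul_smul, ← hab,
      character_mul_left]
  | add v w hv hw => exact (map_add _ v w).trans ((congrArg₂ _ hv hw).trans (map_add _ v w).symm)

/-- The inverse Fourier transform with the structure maps that are the identity on the underlying
Hilbert spaces. -/
noncomputable def inverseFourierCoreMonoidal : (inverseFourierTransform T).CoreMonoidal where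
  εIso := UnitaryRep.mkIso (X := 𝟙_ (UnitaryRep T))
    (Y := (inverseFourierTransform T).obj (𝟙_ (GradedHilb (DualGroup T)))) (LinearEquiv.refl ℂ ℂ)
    fun t (v : ℂ) => by
      refine Eq.symm ((GradedHilb.diagonal_apply (𝟙_ (GradedHilb (DualGroup T))) _
        (GradedHilb.one_mem_unitObj v)).trans ?_)
      rw [character_one_left]
      exact one_smul ℂ v
  μIso X Y := UnitaryRep.mkIso
    (X := (inverseFourierTransform T).obj X ⊗ (inverseFourierTransform T).obj Y)
    (Y := (inverseFourierTransform T).obj (X ⊗ Y)) (LinearEquiv.refl ℂ (X.V ⊗[ℂ] Y.V))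
    (tensor_diagonal_character T X Y)
  μIso_hom_natural_left _ _ := UnitaryRep.hom_ext_two fun _ _ => rfl
  μIso_hom_natural_right _ _ := UnitaryRep.hom_ext_two fun _ _ => rfl
  associativity _ _ _ := UnitaryRep.hom_ext_three fun _ _ _ => rfl
  left_unitality _ := UnitaryRep.hom_ext_two fun _ _ => rfl
  right_unitality _ := UnitaryRep.hom_ext_two fun _ _ => rfl

noncomputable instance inverseFourierBraided : (inverseFourierTransform T).Braided where
  toMonoidal := (inverseFourierCoreMonoidal T).toMonoidal
  braided _ _ := UnitaryRep.hom_ext_two fun _ _ => rfl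

/-- A fully faithful monoidal functor reflects exact pairings, so a dual of `X` is the Fourier
transform of the dual representation of its inverse transform. -/
theorem gradedHilb_exists_dual (X : GradedHilb (DualGroup T)) :
    ∃ Y : GradedHilb (DualGroup T), Nonempty (ExactPairing X Y) := by
  let X' := (inverseFourierTransform T).obj X
  let : ExactPairing ((inverseFourierTransform T).obj X) ((𝟭 (UnitaryRep T)).obj X'.dual) :=
    exactPairingDual X'
  -- The unit isomorphism replaces the dual representation by an object in the image of the inverse
  -- transform, as reflection requires.
  let : ExactPairing ((inverseFourierTransform T).obj X)
      ((inverseFourierTransform T).obj ((fourierTransform T).obj X'.dual)) :=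
    exactPairingCongrRight ((fourierUnitIso T).app X'.dual).symm
  exact ⟨_, ⟨ExactPairing.ofFullyFaithful (inverseFourierTransform T) X
    ((fourierTransform T).obj X'.dual)⟩⟩

theorem fourierTransform_isEquivalence : IsSymmetricTwoHStarEquivalence (fourierTransform T) where
  isTwoHilbertMorphism := fourierTransform_isTwoHilbertMorphism T
  exists_inverse := ⟨inverseFourierTransform T, inferInstance,
    inverseFourierTransform_isTwoHilbertMorphism T, fourierUnitIso T, fourierCounitIso T,
    ⟨rfl, fun _ _ => UnitaryRep.hom_ext_two fun _ _ => rfl⟩,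
    ⟨rfl, fun _ _ => GradedHilb.hom_ext_two fun _ _ => rfl⟩⟩

end Fourier

theorem mainTheorem2 (T : Type u) [CommGroup T] [TopologicalSpace T] [IsTopologicalGroup T]
    [CompactSpace T] :
    IsSymmetricTwoHStarAlgebra (UnitaryRep T) ∧
    IsSymmetricTwoHStarAlgebra (GradedHilb (DualGroup T)) ∧
    ∃ hF : (fourierTransform T).Braided,
      (∀ (X Y : UnitaryRep T) (v : X.V) (w : Y.V),
        (Functor.LaxMonoidal.μ (fourierTransform T) X Y).1 (v ⊗ₜ[ℂ] w) = v ⊗ₜ[ℂ] w) ∧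
      (∀ c : ℂ, (Functor.LaxMonoidal.ε (fourierTransform T)).1 c = c) ∧
      IsSymmetricTwoHStarEquivalence (fourierTransform T) :=
  ⟨UnitaryRep.isSymmetricTwoHStarAlgebra T,
    GradedHilb.isSymmetricTwoHStarAlgebra _ (gradedHilb_isTwoHilbertSpace T)
      (gradedHilb_exists_dual T),
    fourierBraided T, fun _ _ _ _ => rfl, fun _ => rfl, fourierTransform_isEquivalence T⟩
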